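/- For a compact set $D\subset\mathbb{R}^d$, let $\mathcal{P}_n$ be the space of real algebraic polynomials in $d$ variables of total degree at most $n$, put $$C(\mathcal{P}_n,D,\boldsymbol{x})=\sum_{k}\phi_k(\boldsymbol{x})^2,$$ where $\{\phi_k\}$ is any basis of $\mathcal{P}_n$ that is orthonormal in $L_2(D)$ with respect to Lebesgue measure (the sum does not depend on the choice of this basis; its reciprocal is the Christoffel function), and put $C(\mathcal{P}_n,D)=\sup_{\boldsymbol{x}\in D}C(\mathcal{P}_n,D,\boldsymbol{x})$. **Theorem.** Let $d\ge 1$, and let $D\subset\mathbb{R}^d$ be a non-empty compact set whose boundary $\partial D$ is a $(d-1)$-dimensional $C^1$ submanifold of $\mathbb{R}^d$. Suppose that $D$ has an outward pointing unit normal vector $\boldsymbol{n}(\boldsymbol{x})$ at every $\boldsymbol{x}\in\partial D$ (that is, $\boldsymbol{n}(\boldsymbol{x})$ is a unit vector orthogonal to the tangent space of $\partial D$ at $\boldsymbol{x}$, and for all sufficiently small $t>0$ we have $\boldsymbol{x}+t\boldsymbol{n}(\boldsymbol{x})\notin D$ and $\boldsymbol{x}-t\boldsymbol{n}(\boldsymbol{x})\in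 D$), and that for some $L>0$ $$|\boldsymbol{n}(\boldsymbol{x})-\boldsymbol{n}(\boldsymbol{y})|\le L|\boldsymbol{x}-\boldsymbol{y}|,\qquad \boldsymbol{x},\boldsymbol{y}\in\partial D.$$ Then $C(\mathcal{P}_n,D)\approx n^{d+1}$; that is, there is a constant $c>0$, independent of $n$, such that $$c^{-1}n^{d+1}\le C(\mathcal{P}_n,D)\le c\,n^{d+1}\qquad\text{for all } n\ge 1.$$ -/

import Mathlib

open MeasureTheory

/-- The space of real algebraic polynomials in `d` variables of total degree at most `n`, viewed as
functions on Euclidean `d`-space (`aeval` sends the `i`-th variable to the `i`-th coordinate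
function). -/
noncomputable def polySpace (d n : ℕ) : Submodule ℝ (EuclideanSpace ℝ (Fin d) → ℝ) :=
  (MvPolynomial.restrictTotalDegree (Fin d) ℝ n).map
    (MvPolynomial.aeval
      (fun (i : Fin d) (x : EuclideanSpace ℝ (Fin d)) => x i)).toLinearMap

/-- `φ` is a basis of the space of functions `S` that is orthonormal in `L²(D)` with respect to
Lebesgue measure (linear independence follows from orthonormality). -/
structure IsOrthonormalBasisOn {d N : ℕ} (S : Submodule ℝ (EuclideanSpace ℝ (Fin d) → ℝ))
    (D : Set (EuclideanSpace ℝ (Fin d))) (φ : Fin N → EuclideanSpace ℝ (Fin d) → ℝ) : Prop where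
  memLp : ∀ k, MemLp (φ k) 2 (volume.restrict D)
  span_eq : Submodule.span ℝ (Set.range φ) = S
  orthonormal : ∀ j k, ∫ x in D, φ j x * φ k x = if j = k then 1 else 0

open Classical in
/-- The reciprocal `C(S, D, x) = ∑ φ_k(x)²` of the Christoffel function, where `φ` is an orthonormal
basis of `S` on `D`. It does not depend on the basis, see `christoffelAt_eq`. The value is `0` if
there is no orthonormal basis (which for a space of polynomials can happen only if `D` is a null
set or is unbounded). -/
noncomputable def christoffelAt {d : ℕ} (S : Submodule ℝ (EuclideanSpace ℝ (Fin d) → ℝ))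
    (D : Set (EuclideanSpace ℝ (Fin d))) (x : EuclideanSpace ℝ (Fin d)) : ℝ :=
  if h : ∃ φ : Fin (Module.finrank ℝ S) → EuclideanSpace ℝ (Fin d) → ℝ,
      IsOrthonormalBasisOn S D φ
  then ∑ k, (h.choose k x) ^ 2
  else 0

/-- `C(S, D) = sup_{x ∈ D} C(S, D, x)`. -/
noncomputable def christoffelSup {d : ℕ} (S : Submodule ℝ (EuclideanSpace ℝ (Fin d) → ℝ))
    (D : Set (EuclideanSpace ℝ (Fin d))) : ℝ :=
  sSup (christoffelAt S D '' D)

/-- The sum of squares in `christoffelAt` is the same for all orthonormal bases. -/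
theorem christoffelAt_eq {d : ℕ} (S : Submodule ℝ (EuclideanSpace ℝ (Fin d) → ℝ))
    (D : Set (EuclideanSpace ℝ (Fin d)))
    (φ : Fin (Module.finrank ℝ S) → EuclideanSpace ℝ (Fin d) → ℝ)
    (hφ : IsOrthonormalBasisOn S D φ) (x : EuclideanSpace ℝ (Fin d)) :
    christoffelAt S D x = ∑ k, φ k x ^ 2 := by
  have key : ∀ ψ : Fin (Module.finrank ℝ S) → EuclideanSpace ℝ (Fin d) → ℝ,
      IsOrthonormalBasisOn S D ψ → ∑ k, ψ k x ^ 2 = ∑ k, φ k x ^ 2 := by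
    intro ψ hψ
    have hmem : ∀ i, ∃ c : Fin (Module.finrank ℝ S) → ℝ, ∑ j, c j • φ j = ψ i := fun i => by
      rw [← Submodule.mem_span_range_iff_exists_fun ℝ, hφ.span_eq, ← hψ.span_eq]
      exact Submodule.subset_span ⟨i, rfl⟩
    choose A hA using hmem
    have hval : ∀ i y, ψ i y = ∑ j, A i j * φ j y := fun i y => by
      rw [← hA i]; simp [Finset.sum_apply]
    have hint : ∀ j l, Integrable (fun y => φ j y * φ l y) (volume.restrict D) :=
      fun j l => (hφ.memLp j).integrable_mul (hφ.memLp l)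
    have hAA : (Matrix.of A) * (Matrix.of A).transpose = 1 := by
      ext i k
      rw [Matrix.mul_apply, Matrix.one_apply, ← hψ.orthonormal i k]
      have : ∀ y, ψ i y * ψ k y = ∑ j, ∑ l, (A i j * A k l) * (φ j y * φ l y) := fun y => by
        rw [hval i, hval k, Finset.sum_mul_sum]
        exact Finset.sum_congr rfl fun j _ => Finset.sum_congr rfl fun l _ => by ring
      simp_rw [this]
      rw [integral_finsetSum _ fun j _ => integrable_finsetSum _ fun l _ =>
        (hint j l).const_mul _]
      refine Finset.sum_congr rfl fun j _ => ?_
      rw [integral_finsetSum _ fun l _ => (hint j l).const_mul _]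
      simp [integral_const_mul, hφ.orthonormal]
    have hAA' := mul_eq_one_comm.mp hAA
    have hcol : ∀ j l, ∑ i, A i j * A i l = if j = l then (1 : ℝ) else 0 := fun j l => by
      have := congrFun (congrFun hAA' j) l
      simpa [Matrix.mul_apply, Matrix.one_apply] using this
    calc ∑ i, ψ i x ^ 2 = ∑ i, ∑ j, ∑ l, (A i j * A i l) * (φ j x * φ l x) := by
          refine Finset.sum_congr rfl fun i _ => ?_
          rw [hval i, sq, Finset.sum_mul_sum]
          exact Finset.sum_congr rfl fun j _ => Finset.sum_congr rfl fun l _ => by ring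
      _ = ∑ j, ∑ l, (∑ i, A i j * A i l) * (φ j x * φ l x) := by
          rw [Finset.sum_comm]
          refine Finset.sum_congr rfl fun j _ => ?_
          rw [Finset.sum_comm]
          exact Finset.sum_congr rfl fun l _ => (Finset.sum_mul _ _ _).symm
      _ = ∑ k, φ k x ^ 2 := by simp [hcol, sq]
  have h : ∃ φ : Fin (Module.finrank ℝ S) → EuclideanSpace ℝ (Fin d) → ℝ,
      IsOrthonormalBasisOn S D φ := ⟨φ, hφ⟩
  rw [christoffelAt, dif_pos h]
  exact key _ h.choose_spec

/-- On the neighbourhood `U` of `p`, the set `M` is the zero set of the `C¹` function `g`, whose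
differential vanishes nowhere on `U`. -/
structure IsLocalDefiningFunction {d : ℕ} (M : Set (EuclideanSpace ℝ (Fin d)))
    (p : EuclideanSpace ℝ (Fin d)) (U : Set (EuclideanSpace ℝ (Fin d)))
    (g : EuclideanSpace ℝ (Fin d) → ℝ) : Prop where
  isOpen : IsOpen U
  mem : p ∈ U
  contDiffOn : ContDiffOn ℝ 1 g U
  fderiv_ne_zero : ∀ x ∈ U, fderiv ℝ g x ≠ 0
  inter_eq : M ∩ U = {x ∈ U | g x = 0}

/-- `M` is an embedded `(d-1)`-dimensional `C¹` submanifold of Euclidean `d`-space. -/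
def IsC1Hypersurface {d : ℕ} (M : Set (EuclideanSpace ℝ (Fin d))) : Prop :=
  ∀ p ∈ M, ∃ U g, IsLocalDefiningFunction M p U g

/-- The tangent space at `p` of a `C¹` hypersurface `M`: the kernel of the differential at `p` of a
local defining function (all of them have the same kernel). -/
def hypersurfaceTangent {d : ℕ} (M : Set (EuclideanSpace ℝ (Fin d)))
    (p : EuclideanSpace ℝ (Fin d)) : Set (EuclideanSpace ℝ (Fin d)) :=
  {w | ∃ U g, IsLocalDefiningFunction M p U g ∧ fderiv ℝ g p w = 0}

/-- `v` is the outward pointing unit normal vector of `D` at the boundary point `p`: it is a unit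
vector, orthogonal to the tangent space of `∂D` at `p`, and on the normal line the points just
beyond `p` in the direction `v` lie outside `D`, those just before `p` lie in `D`. -/
structure IsOutwardUnitNormal {d : ℕ} (D : Set (EuclideanSpace ℝ (Fin d)))
    (p v : EuclideanSpace ℝ (Fin d)) : Prop where
  norm_eq_one : ‖v‖ = 1
  orthogonal : ∀ w ∈ hypersurfaceTangent (frontier D) p, inner ℝ v w = 0
  outside : ∃ ε > 0, ∀ t : ℝ, 0 < t → t < ε → p + t • v ∉ D
  inside : ∃ ε > 0, ∀ t : ℝ, 0 < t → t < ε → p - t • v ∈ D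

/-! ### Geometry: Lipschitz normals give a uniform interior ball. -/

section Geometry

open Metric Set Filter Topology

/-! By Cauchy–Schwarz and duality, the value at `x` of the sum of squares is the best constant `K`
in `P x ^ 2 ≤ K * ∫ P ^ 2` over polynomials `P` of degree at most `n` (`sq_le_christoffelAt_mul`,
`christoffelAt_le`). So the upper bound is an inequality for all `P`, and the lower bound needs one
good `P` at one good point. Write `d = k + 1`.

Upper bound. Every point of `D` lies on the surface of a ball of a fixed radius contained in `D`
(`exists_closedBall_subset`). This holds because the distance to the complement of the interior
grows at unit speed along inward normals up to depth `1 / (4 * L)` (`infDist_normal_eq`). That ball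
is filled by parabolas through `x` tangent to its surface. On each of them `P` is a univariate
polynomial of degree at most `2 * n`, and the change of variables `(ρ, τ) ↦ (ρ ^ 2, ρ • τ)` has
Jacobian `2 * |ρ| ^ (k + 1)`. The univariate inequality with weight `|ρ| ^ (k + 1)` at the interior
point `0` (`eval_zero_sq_le_integral_weight`) costs `n ^ (k + 2)`, which is the required order;
averaging over the parabolas gives `exists_sq_le_integral_of_closedBall_subset`.

Lower bound. Let `x₀` be a point of `D` farthest from the origin, so that `D` lies in a ball with
`x₀` on its surface. A power of a kernel made from a Chebyshev polynomial
(`exists_polynomial_decay`), applied to the coordinate along `x₀`, equals `1` at `x₀` and lives on a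
cap of depth about `n ^ (-2)`. Such a cap has width about `1 / n` in the other `k` directions, hence
volume of order `n ^ (-(k + 2))` (`exists_mem_polySpace_integral_le`). -/

theorem IsPreconnected.inter_frontier_nonempty {X : Type*} [TopologicalSpace X] {S D : Set X}
    (hS : IsPreconnected S) (h1 : (S ∩ D).Nonempty) (h2 : (S ∩ Dᶜ).Nonempty) :
    (S ∩ frontier D).Nonempty := by
  by_contra h
  have hcover : S ⊆ interior D ∪ interior Dᶜ := by
    intro x hx
    by_contra hx'
    rw [mem_union, interior_compl, not_or, notMem_compl_iff] at hx'
    exact h ⟨x, hx, hx'.2, hx'.1⟩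
  obtain ⟨x, hx, hxD⟩ := h1
  obtain ⟨y, hy, hyD⟩ := h2
  have hx' : x ∈ interior D :=
    (hcover hx).resolve_right fun h => interior_subset h hxD
  have hy' : y ∈ interior Dᶜ :=
    (hcover hy).resolve_left fun h => hyD (interior_subset h)
  obtain ⟨z, -, hz1, hz2⟩ := hS _ _ isOpen_interior isOpen_interior hcover ⟨x, hx, hx'⟩ ⟨y, hy, hy'⟩
  exact interior_subset hz2 (interior_subset hz1)

/-- The component of `v` orthogonal to the gradient of `g` is tangent, hence also orthogonal to `v`,
hence zero. So `v` is a nonzero multiple of the gradient. -/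
theorem IsOutwardUnitNormal.exists_fderiv_eq {d : ℕ} {D : Set (EuclideanSpace ℝ (Fin d))}
    {q v : EuclideanSpace ℝ (Fin d)} (hv : IsOutwardUnitNormal D q v)
    {U : Set (EuclideanSpace ℝ (Fin d))} {g : EuclideanSpace ℝ (Fin d) → ℝ}
    (hg : IsLocalDefiningFunction (frontier D) q U g) :
    ∃ μ : ℝ, μ ≠ 0 ∧ ∀ w, fderiv ℝ g q w = μ * inner ℝ v w := by
  set G := (InnerProductSpace.toDual ℝ (EuclideanSpace ℝ (Fin d))).symm (fderiv ℝ g q) with hG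
  have hGw : ∀ w, fderiv ℝ g q w = inner ℝ G w := fun w => by
    rw [hG, InnerProductSpace.toDual_symm_apply]
  have hG0 : G ≠ 0 := by
    intro h
    apply hg.fderiv_ne_zero q hg.mem
    ext w
    simp [hGw, h]
  have hGG : (inner ℝ G G : ℝ) ≠ 0 := by simpa using hG0
  set c : ℝ := inner ℝ G v / inner ℝ G G with hc
  have hGw0 : inner ℝ G (v - c • G) = 0 := by
    rw [inner_sub_right, inner_smul_right, hc]
    field_simp
    simp
  have hvw : inner ℝ v (v - c • G) = 0 :=
    hv.orthogonal _ ⟨U, g, hg, by rw [hGw, hGw0]⟩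
  have hv_eq : v = c • G := by
    have : inner ℝ (v - c • G) (v - c • G) = 0 := by
      conv_lhs => rw [inner_sub_left, inner_smul_left]
      simp [hGw0, hvw]
    simpa [sub_eq_zero] using this
  have hc0 : c ≠ 0 := by
    intro h
    have h1 := hv.norm_eq_one
    rw [hv_eq, h] at h1
    simp at h1
  refine ⟨c⁻¹, inv_ne_zero hc0, fun w => ?_⟩
  rw [hGw, hv_eq, inner_smul_left]
  simp [hc0]

/-- Points reached from a boundary point in directions transversal to the boundary are not boundary
points, uniformly in the direction. -/
theorem IsOutwardUnitNormal.exists_notMem_frontier {d : ℕ} {D : Set (EuclideanSpace ℝ (Fin d))}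
    (hM : IsC1Hypersurface (frontier D)) {q v : EuclideanSpace ℝ (Fin d)} (hq : q ∈ frontier D)
    (hv : IsOutwardUnitNormal D q v) {κ B : ℝ} (hκ : 0 < κ) (hB : 0 < B) :
    ∃ ε > 0, ∀ t : ℝ, 0 < t → t < ε → ∀ w, ‖w‖ ≤ B → κ ≤ |inner ℝ v w| →
      q + t • w ∉ frontier D := by
  obtain ⟨U, g, hg⟩ := hM q hq
  obtain ⟨μ, hμ, hgμ⟩ := hv.exists_fderiv_eq hg
  have hgq : g q = 0 := by
    have : q ∈ frontier D ∩ U := ⟨hq, hg.mem⟩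
    rw [hg.inter_eq] at this
    exact this.2
  have hdiff : HasFDerivAt g (fderiv ℝ g q) q :=
    ((hg.contDiffOn.contDiffAt (hg.isOpen.mem_nhds hg.mem)).differentiableAt
      (by norm_num)).hasFDerivAt
  -- With this constant the Taylor remainder at `q + t • w` is at most half of the linear term, so
  -- `g` cannot vanish there.
  have hc : 0 < |μ| * κ / (2 * B) := by positivity
  have hev := (hdiff.isLittleO.def hc).and (hg.isOpen.mem_nhds hg.mem)
  obtain ⟨δ, hδ, hball⟩ := Metric.eventually_nhds_iff.mp hev
  refine ⟨δ / B, by positivity, fun t ht htε w hw hκw hmem => ?_⟩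
  have hdist : dist (q + t • w) q < δ := by
    rw [dist_eq_norm, add_sub_cancel_left, norm_smul, Real.norm_of_nonneg ht.le]
    calc t * ‖w‖ ≤ t * B := by gcongr
      _ < δ := by rwa [lt_div_iff₀ hB] at htε
  obtain ⟨h1, h2⟩ := hball hdist
  have hg0 : g (q + t • w) = 0 := by
    have : q + t • w ∈ frontier D ∩ U := ⟨hmem, h2⟩
    rw [hg.inter_eq] at this
    exact this.2
  rw [hg0, hgq, add_sub_cancel_left, hgμ, inner_smul_right, norm_smul,
    Real.norm_of_nonneg ht.le] at h1
  have h3 : ‖(0 : ℝ) - 0 - μ * (t * inner ℝ v w)‖ = |μ| * (t * |inner ℝ v w|) := by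
    simp [abs_of_pos ht]
  rw [h3] at h1
  have h4 : |μ| * (t * κ) ≤ |μ| * (t * |inner ℝ v w|) := by gcongr
  have h5 : |μ| * κ / (2 * B) * (t * ‖w‖) ≤ |μ| * κ / (2 * B) * (t * B) := by gcongr
  have h6 : |μ| * κ / (2 * B) * (t * B) = |μ| * (t * κ) / 2 := by field_simp
  have h7 : 0 < |μ| * (t * κ) := by positivity
  linarith

/-- If a ball contained in `D` touches the boundary at `q`, then its centre lies on the inward
normal line at `q`. -/
theorem IsOutwardUnitNormal.center_eq {d : ℕ} {D : Set (EuclideanSpace ℝ (Fin d))}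
    (hM : IsC1Hypersurface (frontier D)) {q v x : EuclideanSpace ℝ (Fin d)}
    (hq : q ∈ frontier D) (hv : IsOutwardUnitNormal D q v) {f : ℝ} (hf : 0 < f)
    (hball : ball x f ⊆ D) (hxq : dist x q = f) : x = q - f • v := by
  set u : EuclideanSpace ℝ (Fin d) := f⁻¹ • (x - q) with hu
  have hxu : x = q + f • u := by
    rw [hu, smul_inv_smul₀ hf.ne']; abel
  have hun : ‖u‖ = 1 := by
    rw [hu, norm_smul, ← dist_eq_norm, hxq, norm_inv, Real.norm_of_nonneg hf.le,
      inv_mul_cancel₀ hf.ne']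
  have hvn := hv.norm_eq_one
  clear_value u
  have hsq : ‖u + v‖ ^ 2 = 2 * (1 + inner ℝ v u) := by
    rw [norm_add_sq_real, hun, hvn, real_inner_comm]; ring
  by_cases h0 : u + v = 0
  · rw [hxu, eq_neg_of_add_eq_zero_left h0]; simp [sub_eq_add_neg]
  -- If `u ≠ -v`, the point `q + t • (v + u)` lies in the ball while `q + t • v` lies outside `D`.
  -- The segment between them must cross the boundary, yet all its directions `v + θ • u` are
  -- transversal: their inner product with `v` is at least `min 1 (1 + inner ℝ v u) > 0`.
  exfalso
  have ha : 0 < 1 + inner ℝ v u := by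
    have : 0 < ‖u + v‖ ^ 2 := by positivity
    linarith
  obtain ⟨ε₁, hε₁, h₁⟩ := hv.exists_notMem_frontier hM hq (κ := min 1 (1 + inner ℝ v u)) (B := 2)
    (lt_min one_pos ha) two_pos
  obtain ⟨ε₂, hε₂, h₂⟩ := hv.outside
  obtain ⟨t, ht0, ht⟩ := exists_between (lt_min (lt_min hε₁ hε₂) hf)
  simp only [lt_min_iff] at ht
  have hin : q + t • (v + (1 : ℝ) • u) ∈ D := by
    apply hball
    rw [mem_ball, dist_eq_norm, hxu]
    have e : q + t • (v + (1 : ℝ) • u) - (q + f • u) = t • (u + v) - f • u := by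
      rw [one_smul, add_comm v u]; abel
    rw [e]
    refine lt_of_pow_lt_pow_left₀ 2 hf.le ?_
    rw [norm_sub_sq_real, norm_smul, norm_smul, inner_smul_left, inner_smul_right, mul_pow, mul_pow,
      hsq, inner_add_left, real_inner_self_eq_norm_sq, hun]
    simp only [Real.norm_eq_abs, sq_abs, RCLike.conj_to_real]
    have : t * (t * (1 + inner ℝ v u)) < f * (t * (1 + inner ℝ v u)) :=
      mul_lt_mul_of_pos_right ht.2 (by positivity)
    nlinarith
  have hout : q + t • (v + (0 : ℝ) • u) ∉ D := by
    simpa using h₂ t ht0 ht.1.2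
  set S : Set (EuclideanSpace ℝ (Fin d)) := (fun θ : ℝ => q + t • (v + θ • u)) '' Icc 0 1 with hS
  have hSc : IsPreconnected S := isPreconnected_Icc.image _ (by fun_prop)
  obtain ⟨_, ⟨θ, hθ, rfl⟩, hfr⟩ := hSc.inter_frontier_nonempty
    ⟨_, ⟨1, by simp, rfl⟩, hin⟩ ⟨_, ⟨0, by simp, rfl⟩, hout⟩
  refine h₁ t ht0 ht.1.1 (v + θ • u) ?_ ?_ hfr
  · calc ‖v + θ • u‖ ≤ ‖v‖ + ‖θ • u‖ := norm_add_le _ _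
      _ ≤ 2 := by
        rw [norm_smul, hun, hvn, Real.norm_of_nonneg hθ.1]; linarith [hθ.2]
  · rw [inner_add_right, real_inner_smul_right, real_inner_self_eq_norm_sq, hvn, one_pow]
    refine le_trans ?_ (le_abs_self _)
    rcases le_total 0 (inner ℝ v u) with h | h
    · exact (min_le_left _ _).trans (by nlinarith [hθ.1])
    · exact (min_le_right _ _).trans (by nlinarith [hθ.2])


/-- The largest ball about `x` inside the interior touches the boundary at a nearest point `q`, so
`center_eq` applies; at distance zero `x` is its own foot. -/
theorem exists_eq_sub_infDist_smul {d : ℕ} {D : Set (EuclideanSpace ℝ (Fin d))}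
    (hM : IsC1Hypersurface (frontier D))
    {ν : EuclideanSpace ℝ (Fin d) → EuclideanSpace ℝ (Fin d)}
    (hν : ∀ x ∈ frontier D, IsOutwardUnitNormal D x (ν x)) (hne : (frontier D).Nonempty)
    {x : EuclideanSpace ℝ (Fin d)} (hx : x ∈ D) :
    ∃ q ∈ frontier D, dist x q = infDist x (interior D)ᶜ ∧
      x = q - infDist x (interior D)ᶜ • ν q := by
  rcases (infDist_nonneg (x := x) (s := (interior D)ᶜ)).eq_or_lt' with h0 | hpos
  · have hx' : x ∈ (interior D)ᶜ := by
      rw [isOpen_interior.isClosed_compl.mem_iff_infDist_zero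
        (hne.mono fun y hy => hy.2)]
      exact h0
    exact ⟨x, ⟨subset_closure hx, hx'⟩, by simp [h0], by simp [h0]⟩
  · obtain ⟨q, hq, hxq⟩ := isOpen_interior.isClosed_compl.exists_infDist_eq_dist
      (hne.mono fun y hy => hy.2) x
    have hball : ball x (infDist x (interior D)ᶜ) ⊆ D :=
      ball_infDist_compl_subset.trans interior_subset
    have hqD : q ∈ closure D := by
      refine closure_mono hball ?_
      rw [closure_ball _ hpos.ne', mem_closedBall, dist_comm, hxq]
    exact ⟨q, ⟨hqD, hq⟩, hxq.symm,
      (hν q ⟨hqD, hq⟩).center_eq hM ⟨hqD, hq⟩ hpos hball hxq.symm⟩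

section NormalLine

variable {d : ℕ} {D : Set (EuclideanSpace ℝ (Fin d))}
  {ν : EuclideanSpace ℝ (Fin d) → EuclideanSpace ℝ (Fin d)} {L : ℝ}

/-- Along an inward normal line, the distance to the complement satisfies a one-sided quadratic
estimate in the defect `t - infDist`. -/
theorem infDist_sq_le_of_normal (hM : IsC1Hypersurface (frontier D))
    (hν : ∀ x ∈ frontier D, IsOutwardUnitNormal D x (ν x)) (hL : 0 < L)
    (hLip : ∀ x ∈ frontier D, ∀ y ∈ frontier D, ‖ν x - ν y‖ ≤ L * ‖x - y‖)
    {p : EuclideanSpace ℝ (Fin d)} (hp : p ∈ frontier D) {s t : ℝ} (ht : 0 ≤ t)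
    (htL : t * (4 * L) ≤ 1) (hst : s ≤ t) (htD : p - t • ν p ∈ D) :
    infDist (p - s • ν p) (interior D)ᶜ ^ 2 ≤
      (infDist (p - t • ν p) (interior D)ᶜ - (t - s)) ^ 2 +
        4 * L ^ 2 * (t - s) * infDist (p - t • ν p) (interior D)ᶜ *
          (t - infDist (p - t • ν p) (interior D)ᶜ) ^ 2 := by
  obtain ⟨q, hq, hdq, hcq⟩ := exists_eq_sub_infDist_smul hM hν ⟨p, hp⟩ htD
  set f := infDist (p - t • ν p) (interior D)ᶜ with hf
  have hf0 : 0 ≤ f := infDist_nonneg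
  have hνp := (hν p hp).norm_eq_one
  have hνq := (hν q hq).norm_eq_one
  have hft : f ≤ t := by
    have : f ≤ dist (p - t • ν p) p := infDist_le_dist_of_mem hp.2
    rwa [dist_eq_norm, sub_sub_cancel_left, norm_neg, norm_smul, hνp, mul_one,
      Real.norm_of_nonneg ht] at this
  -- If the foot `q` differs from `p`, its displacement is controlled by the defect `t - f`: the
  -- part caused by the turning of the normal is absorbed on the left because `f * L ≤ 1 / 4`.
  have hpq : ‖p - q‖ ≤ 2 * (t - f) := by
    have e : p - q = (t - f) • ν p + f • (ν p - ν q) := by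
      have : p - q = t • ν p - f • ν q := by
        calc p - q = t • ν p + (p - t • ν p) - q := by abel
          _ = t • ν p - f • ν q := by rw [hcq]; abel
      rw [this, sub_smul, smul_sub]; abel
    have h1 : ‖p - q‖ ≤ (t - f) + f * (L * ‖p - q‖) := by
      calc ‖p - q‖ = ‖(t - f) • ν p + f • (ν p - ν q)‖ := by rw [← e]
        _ ≤ ‖(t - f) • ν p‖ + ‖f • (ν p - ν q)‖ := norm_add_le _ _
        _ ≤ (t - f) + f * (L * ‖p - q‖) := by
          rw [norm_smul, norm_smul, hνp, mul_one, Real.norm_of_nonneg hf0,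
            Real.norm_of_nonneg (sub_nonneg.2 hft)]
          gcongr
          exact hLip p hp q hq
    have h2 : f * L ≤ 1 / 4 := by nlinarith
    nlinarith [norm_nonneg (p - q)]
  have hνν : ‖ν p - ν q‖ ^ 2 ≤ 4 * L ^ 2 * (t - f) ^ 2 := by
    calc ‖ν p - ν q‖ ^ 2 ≤ (L * (2 * (t - f))) ^ 2 := by
          gcongr
          exact (hLip p hp q hq).trans (by gcongr)
      _ = _ := by ring
  -- The same `q` serves as a competitor for the point at depth `s`. As both normals are unit
  -- vectors, `‖ν p - ν q‖` enters only squared, which makes the error quadratic in the defect.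
  have hle : infDist (p - s • ν p) (interior D)ᶜ ≤ ‖(t - s) • ν p - f • ν q‖ := by
    have h3 : p - s • ν p - q = (t - s) • ν p - f • ν q := by
      have : p - s • ν p - q = (p - t • ν p) + (t - s) • ν p - q := by
        rw [sub_smul]; abel
      rw [this, hcq]; abel
    rw [← h3, ← dist_eq_norm]
    exact infDist_le_dist_of_mem hq.2
  calc infDist (p - s • ν p) (interior D)ᶜ ^ 2 ≤ ‖(t - s) • ν p - f • ν q‖ ^ 2 := by
        gcongr
        exact infDist_nonneg
    _ = (f - (t - s)) ^ 2 + (t - s) * f * ‖ν p - ν q‖ ^ 2 := by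
        rw [norm_sub_sq_real, norm_sub_sq_real, norm_smul, norm_smul, inner_smul_left,
          inner_smul_right, hνp, hνq]
        simp only [Real.norm_eq_abs, mul_one, sq_abs, RCLike.conj_to_real]
        ring
    _ ≤ (f - (t - s)) ^ 2 + (t - s) * f * (4 * L ^ 2 * (t - f) ^ 2) := by
        have : 0 ≤ (t - s) * f := mul_nonneg (sub_nonneg.2 hst) hf0
        gcongr
    _ = _ := by ring

theorem infDist_sub_smul_le (hν : ∀ x ∈ frontier D, IsOutwardUnitNormal D x (ν x))
    {p : EuclideanSpace ℝ (Fin d)} (hp : p ∈ frontier D) {t : ℝ} (ht : 0 ≤ t) :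
    infDist (p - t • ν p) (interior D)ᶜ ≤ t := by
  have : infDist (p - t • ν p) (interior D)ᶜ ≤ dist (p - t • ν p) p :=
    infDist_le_dist_of_mem hp.2
  rwa [dist_eq_norm, sub_sub_cancel_left, norm_neg, norm_smul, (hν p hp).norm_eq_one, mul_one,
    Real.norm_of_nonneg ht] at this

/-- Heuristically the defect `E(t) = t - f t` satisfies `E' ≤ 2 * L ^ 2 * E ^ 2` and `E(0) = 0`, so
it vanishes. Differentiability of `f` is not available, so the inequality is tested at a maximum of
the defect penalised by a linear term. -/
theorem infDist_normal_eq_of_pos (hM : IsC1Hypersurface (frontier D))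
    (hν : ∀ x ∈ frontier D, IsOutwardUnitNormal D x (ν x)) (hL : 0 < L)
    (hLip : ∀ x ∈ frontier D, ∀ y ∈ frontier D, ‖ν x - ν y‖ ≤ L * ‖x - y‖)
    {p : EuclideanSpace ℝ (Fin d)} (hp : p ∈ frontier D) {T : ℝ}
    (hTL : T * (4 * L) ≤ 1)
    (hpos : ∀ t, 0 < t → t ≤ T → 0 < infDist (p - t • ν p) (interior D)ᶜ)
    {t : ℝ} (ht0 : 0 ≤ t) (htT : t ≤ T) :
    infDist (p - t • ν p) (interior D)ᶜ = t := by
  set f : ℝ → ℝ := fun t => infDist (p - t • ν p) (interior D)ᶜ with hf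
  have hfc : Continuous f := (continuous_infDist_pt _).comp (by fun_prop)
  have hfle : ∀ t, 0 ≤ t → f t ≤ t := fun t ht => infDist_sub_smul_le hν hp ht
  have hf0 : ∀ t, 0 ≤ f t := fun t => infDist_nonneg
  have hT0 : 0 ≤ T := ht0.trans htT
  obtain ⟨a, ha, hamax⟩ := isCompact_Icc.exists_isMaxOn (nonempty_Icc.2 hT0)
    (f := fun t => t - f t) (by fun_prop)
  refine le_antisymm (hfle t ht0) ?_
  by_contra hlt
  push Not at hlt
  have hE : 0 < a - f a := by
    have := hamax ⟨ht0, htT⟩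
    simp only [mem_ofPred_eq] at this
    linarith
  set E := a - f a with hEdef
  have hapos : 0 < a := by linarith [hf0 a]
  have hTpos : 0 < T := hapos.trans_le ha.2
  have hET : E ≤ T := by linarith [hf0 a, ha.2]
  -- The slope is small enough that the penalised maximum is at least `E / 2 > 0`, which forces the
  -- maximiser `b` away from `0`.
  set lam := E / (2 * T) with hlam
  have hlampos : 0 < lam := by positivity
  obtain ⟨b, hb, hbmax⟩ := isCompact_Icc.exists_isMaxOn (nonempty_Icc.2 hT0)
    (f := fun t => t - f t - lam * t) (by fun_prop)
  have hlamT : lam * T = E / 2 := by rw [hlam]; field_simp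
  have hba : E / 2 ≤ b - f b - lam * b := by
    have := hbmax ha
    simp only [mem_ofPred_eq] at this
    nlinarith [ha.2]
  have hlamb : 0 ≤ lam * b := mul_nonneg hlampos.le hb.1
  have hbpos : 0 < b := by
    by_contra h
    have : b = 0 := le_antisymm (not_lt.1 h) hb.1
    rw [this] at hba
    linarith [hf0 0]
  have hfb : 0 < f b := hpos b hbpos hb.2
  have hbE : b - f b ≤ E := hamax hb
  have hbD : p - b • ν p ∈ D := by
    have : p - b • ν p ∈ interior D := by
      by_contra h
      have : f b = 0 := infDist_zero_of_mem (s := (interior D)ᶜ) h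
      linarith
    exact interior_subset this
  have hlam_lt : lam < 1 := by
    rw [hlam, div_lt_one (by positivity)]; linarith
  have key : ∀ h : ℝ, 0 < h → h ≤ b → h ≤ f b →
      2 * lam ≤ h / f b + 4 * L ^ 2 * E ^ 2 := by
    intro h hh hhb hhf
    have h1 := infDist_sq_le_of_normal hM hν hL hLip hp (s := b - h) hb.1
      (le_trans (by gcongr; exact hb.2) hTL) (by linarith) hbD
    change f (b - h) ^ 2 ≤ (f b - (b - (b - h))) ^ 2 +
      4 * L ^ 2 * (b - (b - h)) * f b * (b - f b) ^ 2 at h1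
    rw [sub_sub_cancel] at h1
    have h2 := hbmax (show b - h ∈ Icc 0 T from ⟨by linarith, by linarith [hb.2]⟩)
    simp only [mem_ofPred_eq] at h2
    have h3 : f b - (1 - lam) * h ≤ f (b - h) := by linarith
    have h4 : 0 ≤ f b - (1 - lam) * h := by nlinarith
    have h5 : (f b - (1 - lam) * h) ^ 2 ≤ f (b - h) ^ 2 := by gcongr
    have h6 : (b - f b) ^ 2 ≤ E ^ 2 := by
      gcongr
      linarith [hfle b hb.1]
    have h7 : 4 * L ^ 2 * h * f b * (b - f b) ^ 2 ≤ 4 * L ^ 2 * h * f b * E ^ 2 := by gcongr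
    have h8 : h * (2 * lam * f b) ≤ h * (h + 4 * L ^ 2 * E ^ 2 * f b) := by
      nlinarith [sq_nonneg ((1 - lam) * h)]
    have h9 := le_of_mul_le_mul_left h8 hh
    rw [show h / f b + 4 * L ^ 2 * E ^ 2 = (h + 4 * L ^ 2 * E ^ 2 * f b) / f b by field_simp,
      le_div_iff₀ hfb]
    exact h9
  -- Letting the backward step `h` tend to `0` gives the inequality that `E'` would satisfy. It
  -- yields `1 ≤ 4 * L ^ 2 * E * T`, impossible since `E ≤ T` and `4 * L * T ≤ 1`.
  have hlim : 2 * lam ≤ 4 * L ^ 2 * E ^ 2 := by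
    have htend : Tendsto (fun h : ℝ => h / f b + 4 * L ^ 2 * E ^ 2) (𝓝[>] 0)
        (𝓝 (0 / f b + 4 * L ^ 2 * E ^ 2)) :=
      (Continuous.tendsto (by fun_prop) 0).mono_left nhdsWithin_le_nhds
    rw [zero_div, zero_add] at htend
    refine ge_of_tendsto htend ?_
    filter_upwards [Ioc_mem_nhdsGT (lt_min hbpos hfb)] with h hh
    exact key h hh.1 (hh.2.trans (min_le_left _ _)) (hh.2.trans (min_le_right _ _))
  have h10 : E / T ≤ 4 * L ^ 2 * E ^ 2 := by
    rw [hlam] at hlim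
    calc E / T = 2 * (E / (2 * T)) := by field_simp
      _ ≤ _ := hlim
  rw [div_le_iff₀ hTpos] at h10
  have h11 : 1 ≤ 4 * L ^ 2 * E * T := by
    refine le_of_mul_le_mul_left ?_ hE
    linarith
  have h12 : 4 * L ^ 2 * E * T ≤ 4 * L ^ 2 * T * T := by gcongr
  nlinarith [mul_pos hL hTpos]

/-- Positivity of `f` holds near `0` by transversality of the normal line. At a first later zero
`a`, the identity `f r = r` for `r < a` and continuity would give `f a = a > 0`. -/
theorem infDist_normal_eq (hM : IsC1Hypersurface (frontier D))
    (hν : ∀ x ∈ frontier D, IsOutwardUnitNormal D x (ν x)) (hL : 0 < L)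
    (hLip : ∀ x ∈ frontier D, ∀ y ∈ frontier D, ‖ν x - ν y‖ ≤ L * ‖x - y‖)
    {p : EuclideanSpace ℝ (Fin d)} (hp : p ∈ frontier D)
    {t : ℝ} (ht0 : 0 ≤ t) (htL : t * (4 * L) ≤ 1) :
    infDist (p - t • ν p) (interior D)ᶜ = t := by
  set f : ℝ → ℝ := fun t => infDist (p - t • ν p) (interior D)ᶜ with hf
  have hfc : Continuous f := (continuous_infDist_pt _).comp (by fun_prop)
  have hf0 : ∀ t, 0 ≤ f t := fun t => infDist_nonneg
  have hcne : ((interior D)ᶜ).Nonempty := ⟨p, hp.2⟩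
  have hfrontier : ∀ s, p - s • ν p ∈ D → f s = 0 → p - s • ν p ∈ frontier D := by
    intro s hs h0
    refine ⟨subset_closure hs, ?_⟩
    exact (isOpen_interior.isClosed_compl.mem_iff_infDist_zero hcne).2 h0
  obtain ⟨ε, hε, hpos⟩ : ∃ ε > 0, ∀ s, 0 < s → s < ε → 0 < f s := by
    obtain ⟨ε₁, hε₁, h₁⟩ := (hν p hp).inside
    obtain ⟨ε₂, hε₂, h₂⟩ := (hν p hp).exists_notMem_frontier hM hp one_pos one_pos
    refine ⟨min ε₁ ε₂, lt_min hε₁ hε₂, fun s hs hsε => (hf0 s).lt_of_ne' fun h => ?_⟩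
    refine h₂ s hs (hsε.trans_le (min_le_right _ _)) (-ν p) ?_ ?_ ?_
    · rw [norm_neg, (hν p hp).norm_eq_one]
    · rw [inner_neg_right, real_inner_self_eq_norm_sq, (hν p hp).norm_eq_one]; simp
    · rw [smul_neg, ← sub_eq_add_neg]
      exact hfrontier s (h₁ s hs (hsε.trans_le (min_le_left _ _))) h
  refine infDist_normal_eq_of_pos hM hν hL hLip hp htL ?_ ht0 le_rfl
  by_contra hcon
  push Not at hcon
  obtain ⟨s, hs0, hst, hfs⟩ := hcon
  have hεs : ε ≤ s := by
    by_contra h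
    exact (hpos s hs0 (not_le.1 h)).not_ge hfs
  have hcomp : IsCompact (Icc ε t ∩ f ⁻¹' {0}) :=
    isCompact_Icc.inter_right (isClosed_singleton.preimage hfc)
  obtain ⟨a, ⟨ha, hfa⟩, hamin⟩ := hcomp.exists_isLeast ⟨s, ⟨hεs, hst⟩, le_antisymm hfs (hf0 s)⟩
  have hapos : 0 < a := hε.trans_le ha.1
  have hlt : ∀ r, 0 < r → r < a → 0 < f r := by
    intro r hr hra
    rcases lt_or_ge r ε with h | h
    · exact hpos r hr h
    · refine (hf0 r).lt_of_ne' fun h0 => ?_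
      exact (hamin ⟨⟨h, hra.le.trans ha.2⟩, h0⟩).not_gt hra
  have heq : ∀ r ∈ Ioo 0 a, f r = r := fun r hr =>
    infDist_normal_eq_of_pos hM hν hL hLip hp (T := r)
      (le_trans (by gcongr; exact hr.2.le.trans ha.2) htL)
      (fun r' h1 h2 => hlt r' h1 (h2.trans_lt hr.2)) hr.1.le le_rfl
  have h1 : Tendsto f (𝓝[<] a) (𝓝 (f a)) := hfc.continuousAt.mono_left nhdsWithin_le_nhds
  have h2 : Tendsto f (𝓝[<] a) (𝓝 a) := by
    refine Tendsto.congr' ?_ (tendsto_id.mono_left nhdsWithin_le_nhds)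
    filter_upwards [Ioo_mem_nhdsLT hapos] with r hr
    exact (heq r hr).symm
  have h3 := tendsto_nhds_unique h1 h2
  rw [show f a = 0 from hfa] at h3
  exact hapos.ne h3

/-- The uniform interior ball condition. -/
theorem exists_closedBall_subset (hD : IsClosed D)
    (hne : (frontier D).Nonempty) (hM : IsC1Hypersurface (frontier D))
    (hν : ∀ x ∈ frontier D, IsOutwardUnitNormal D x (ν x)) (hL : 0 < L)
    (hLip : ∀ x ∈ frontier D, ∀ y ∈ frontier D, ‖ν x - ν y‖ ≤ L * ‖x - y‖) :
    ∃ r > 0, ∀ x ∈ D, ∃ e : EuclideanSpace ℝ (Fin d), ‖e‖ = 1 ∧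
      closedBall (x + r • e) r ⊆ D := by
  -- A point at depth at most `2 * r` needs a ball centred at depth at most `3 * r = 1 / (4 * L)`,
  -- the limit of `infDist_normal_eq`. Deeper points already have room around them.
  refine ⟨1 / (12 * L), by positivity, fun x hx => ?_⟩
  set r := 1 / (12 * L) with hr
  have hr0 : 0 < r := by positivity
  have hrL : r * (12 * L) = 1 := by rw [hr]; field_simp
  suffices h : ∃ e : EuclideanSpace ℝ (Fin d), ‖e‖ = 1 ∧ ball (x + r • e) r ⊆ D by
    obtain ⟨e, he, hb⟩ := h
    refine ⟨e, he, ?_⟩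
    rw [← closure_ball _ hr0.ne']
    exact closure_minimal hb hD
  obtain ⟨q, hq, -, hxq⟩ := exists_eq_sub_infDist_smul hM hν hne hx
  set ρ := infDist x (interior D)ᶜ with hρ
  have hρ0 : 0 ≤ ρ := infDist_nonneg
  have hqn : ‖-ν q‖ = 1 := by rw [norm_neg, (hν q hq).norm_eq_one]
  refine ⟨-ν q, hqn, ?_⟩
  rcases le_total ρ (2 * r) with h | h
  · have hc : x + r • -ν q = q - (ρ + r) • ν q := by
      rw [hxq, add_smul, smul_neg]; abel
    have h1 := infDist_normal_eq hM hν hL hLip hq (t := ρ + r) (by linarith) (by nlinarith)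
    rw [hc]
    calc ball (q - (ρ + r) • ν q) r ⊆ ball (q - (ρ + r) • ν q)
          (infDist (q - (ρ + r) • ν q) (interior D)ᶜ) := ball_subset_ball (by linarith)
      _ ⊆ interior D := ball_infDist_compl_subset
      _ ⊆ D := interior_subset
  · calc ball (x + r • -ν q) r ⊆ ball x ρ := by
          refine ball_subset_ball' ?_
          rw [dist_eq_norm, add_sub_cancel_left, norm_smul, hqn, Real.norm_of_nonneg hr0.le]
          linarith
      _ ⊆ interior D := ball_infDist_compl_subset
      _ ⊆ D := interior_subset

end NormalLine

end Geometry

/-! ### Univariate polynomial inequalities and a decaying kernel. -/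

section Univariate

open Polynomial Polynomial.Chebyshev

theorem exists_eq_sum_chebyshev_T {q : ℝ[X]} {N : ℕ} (hq : q.natDegree ≤ N) :
    ∃ c : ℕ → ℝ, q = ∑ i ∈ Finset.range (N + 1), c i • T ℝ i := by
  have hmem : q ∈ degreeLT ℝ (N + 1) := by
    rw [mem_degreeLT]
    exact degree_le_natDegree.trans_lt (by exact_mod_cast Nat.lt_succ_of_le hq)
  rw [← Sequence.span_degreeLT (chebyshevTsequence ℝ) (by simp),
    show Set.Iio (N + 1) = Finset.range (N + 1) by simp,
    Submodule.mem_span_image_finset_iff_exists_fun'] at hmem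
  obtain ⟨c, rfl⟩ := hmem
  exact ⟨c, rfl⟩

/-- Expand in Chebyshev polynomials: these are bounded by `1` on the interval and have squared norm
`π` or `π / 2`, both at least `1`. Then apply Cauchy–Schwarz to the `N + 1` terms. -/
theorem eval_sq_le_integral_measureT {q : ℝ[X]} {N : ℕ} (hq : q.natDegree ≤ N) {x : ℝ}
    (hx : |x| ≤ 1) : q.eval x ^ 2 ≤ (N + 1) * ∫ y, q.eval y ^ 2 ∂measureT := by
  obtain ⟨c, rfl⟩ := exists_eq_sum_chebyshev_T hq
  have hTT : ∀ i j : ℕ, ∫ y, (T ℝ i).eval y * (T ℝ j).eval y ∂measureT =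
      if i = j then (if i = 0 then Real.pi else Real.pi / 2) else 0 := by
    intro i j
    split_ifs with h h0
    · subst h; subst h0; exact integral_eval_T_real_mul_self_measureT_zero
    · subst h; exact integral_T_real_mul_self_measureT_of_ne_zero h0
    · exact integral_eval_T_real_mul_eval_T_real_measureT_of_ne h
  have hint : ∀ i j : ℕ, Integrable (fun y => (T ℝ i).eval y * (T ℝ j).eval y) measureT :=
    fun i j => integrable_measureT (by fun_prop)
  have hI : ∫ y, (∑ i ∈ Finset.range (N + 1), c i • T ℝ i).eval y ^ 2 ∂measureT =
      ∑ i ∈ Finset.range (N + 1), c i ^ 2 * (if i = 0 then Real.pi else Real.pi / 2) := by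
    have e : ∀ y, (∑ i ∈ Finset.range (N + 1), c i • T ℝ i).eval y ^ 2 =
        ∑ i ∈ Finset.range (N + 1), ∑ j ∈ Finset.range (N + 1),
          (c i * c j) * ((T ℝ i).eval y * (T ℝ j).eval y) := fun y => by
      rw [eval_finsetSum, sq, Finset.sum_mul_sum]
      refine Finset.sum_congr rfl fun i _ => Finset.sum_congr rfl fun j _ => ?_
      rw [eval_smul, eval_smul, smul_eq_mul, smul_eq_mul]; ring
    simp_rw [e]
    rw [integral_finsetSum _ fun i _ => integrable_finsetSum _ fun j _ => (hint i j).const_mul _]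
    refine Finset.sum_congr rfl fun i hi => ?_
    rw [integral_finsetSum _ fun j _ => (hint i j).const_mul _]
    simp_rw [integral_const_mul, hTT]
    rw [Finset.sum_eq_single i]
    · rw [if_pos rfl, sq]
    · intro j _ hj; rw [if_neg hj.symm, mul_zero]
    · exact fun h => (h hi).elim
  have h1 : ∑ i ∈ Finset.range (N + 1), c i ^ 2 ≤
      ∑ i ∈ Finset.range (N + 1), c i ^ 2 * (if i = 0 then Real.pi else Real.pi / 2) := by
    refine Finset.sum_le_sum fun i _ => le_mul_of_one_le_right (sq_nonneg _) ?_
    split_ifs <;> linarith [Real.pi_gt_three]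
  rw [hI]
  refine le_trans ?_ (mul_le_mul_of_nonneg_left h1 (by positivity))
  have h2 := sq_sum_le_card_mul_sum_sq (s := Finset.range (N + 1))
    (f := fun i => (c i • T ℝ i).eval x)
  rw [Finset.card_range] at h2
  push_cast at h2
  rw [eval_finsetSum]
  refine h2.trans (mul_le_mul_of_nonneg_left (Finset.sum_le_sum fun i _ => ?_) (by positivity))
  rw [eval_smul, smul_eq_mul, mul_pow]
  refine mul_le_of_le_one_right (sq_nonneg _) ?_
  rw [sq_le_one_iff_abs_le_one]
  exact abs_eval_T_real_le_one _ hx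

/-- The factor `1 - X ^ 2` equals `1` at `0` and cancels the endpoint singularity of the Chebyshev
weight, at the cost of two degrees. -/
theorem eval_zero_sq_le_integral {q : ℝ[X]} {N : ℕ} (hq : q.natDegree ≤ N) :
    q.eval 0 ^ 2 ≤ (N + 3) * ∫ y in (-1)..1, q.eval y ^ 2 := by
  have hdeg : (q * (1 - X ^ 2)).natDegree ≤ N + 2 := by
    refine natDegree_mul_le.trans (add_le_add hq ?_)
    compute_degree
  have h1 := eval_sq_le_integral_measureT hdeg (x := 0) (by simp)
  rw [integral_measureT] at h1
  have h2 : ∫ x in (-1)..1, (q * (1 - X ^ 2)).eval x ^ 2 * √(1 - x ^ 2)⁻¹ ≤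
      ∫ y in (-1)..1, q.eval y ^ 2 := by
    refine intervalIntegral.integral_mono_on (by norm_num)
      (intervalIntegrable_sqrt_one_sub_sq_inv.continuousOn_mul (by fun_prop))
      (Continuous.intervalIntegrable (by fun_prop) _ _) fun x hx => ?_
    have hy0 : 0 ≤ 1 - x ^ 2 := by nlinarith [hx.1, hx.2]
    have hy1 : 1 - x ^ 2 ≤ 1 := by nlinarith
    rw [eval_mul, mul_pow, mul_assoc]
    refine mul_le_of_le_one_right (sq_nonneg _) ?_
    simp only [eval_sub, eval_one, eval_pow, eval_X]
    set y := 1 - x ^ 2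
    rw [Real.sqrt_inv]
    rcases hy0.eq_or_lt with h | h
    · rw [← h]; simp
    · rw [← div_eq_mul_inv, div_le_one (Real.sqrt_pos.2 h)]
      refine Real.le_sqrt_of_sq_le ?_
      calc (y ^ 2) ^ 2 = y ^ 3 * y := by ring
        _ ≤ 1 * y := by gcongr; exact pow_le_one₀ hy0 hy1
        _ = y := one_mul y
  simp only [eval_mul, eval_sub, eval_one, eval_pow, eval_X] at h1 h2
  calc q.eval 0 ^ 2 = (q.eval 0 * (1 - 0 ^ 2)) ^ 2 := by ring
    _ ≤ _ := h1
    _ ≤ _ := by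
      push_cast
      rw [show ((N : ℝ) + 2 + 1) = N + 3 by ring]
      exact mul_le_mul_of_nonneg_left h2 (by positivity)

theorem eval_sq_le_integral {q : ℝ[X]} {N : ℕ} (hq : q.natDegree ≤ N) {x : ℝ} (hx : |x| ≤ 1 / 2) :
    q.eval x ^ 2 ≤ 2 * (N + 3) * ∫ y in (-1)..1, q.eval y ^ 2 := by
  rw [abs_le] at hx
  have hdeg : (q.comp (C x + C (1 / 2) * X)).natDegree ≤ N := by
    refine natDegree_comp_le.trans ?_
    calc q.natDegree * (C x + C (1 / 2) * X : ℝ[X]).natDegree ≤ N * 1 := by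
          gcongr
          compute_degree
      _ = N := mul_one N
  have h1 := eval_zero_sq_le_integral hdeg
  simp only [eval_comp, eval_add, eval_C, eval_mul, eval_X, mul_zero, add_zero] at h1
  rw [intervalIntegral.integral_comp_add_mul (fun y => q.eval y ^ 2) (by norm_num) x] at h1
  have h2 : ∫ y in (x + 1 / 2 * -1)..(x + 1 / 2 * 1), q.eval y ^ 2 ≤
      ∫ y in (-1)..1, q.eval y ^ 2 := by
    refine intervalIntegral.integral_mono_interval (by linarith) (by linarith) (by linarith)
      (Filter.Eventually.of_forall fun y => sq_nonneg _)
      (Continuous.intervalIntegrable (by fun_prop) _ _)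
  calc q.eval x ^ 2 ≤ _ := h1
    _ = 2 * (N + 3) * ∫ y in (x + 1 / 2 * -1)..(x + 1 / 2 * 1), q.eval y ^ 2 := by
      rw [smul_eq_mul]; ring
    _ ≤ _ := by gcongr

/-- The unweighted bound `q ^ 2 ≤ 8 * N * I` near `0` shows that `[-h, h]`, with `h = 1 / (32 * N)`,
carries at most half of `I = ∫ q ^ 2`. On the remainder the weight is at least `h ^ a`. -/
theorem eval_zero_sq_le_integral_weight {q : ℝ[X]} {N : ℕ} (hN : 1 ≤ N) (hq : q.natDegree ≤ N)
    (a : ℕ) :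
    q.eval 0 ^ 2 ≤ 16 * N * (32 * N) ^ a * ∫ y in (-1)..1, |y| ^ a * q.eval y ^ 2 := by
  have hN' : (1 : ℝ) ≤ N := by exact_mod_cast hN
  set h : ℝ := 1 / (32 * N) with hh
  have hpos : 0 < h := by positivity
  have hhN : h * (32 * N) = 1 := by rw [hh]; field_simp
  have hle : h ≤ 1 / 32 := by nlinarith
  set I := ∫ y in (-1)..1, q.eval y ^ 2 with hI
  have hI0 : 0 ≤ I := intervalIntegral.integral_nonneg (by norm_num) fun _ _ => sq_nonneg _
  have hpt : ∀ x : ℝ, |x| ≤ 1 / 2 → q.eval x ^ 2 ≤ 8 * N * I := fun x hx => by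
    exact (eval_sq_le_integral hq hx).trans (mul_le_mul_of_nonneg_right (by linarith) hI0)
  have hii : ∀ b c : ℝ, IntervalIntegrable (fun y => q.eval y ^ 2) volume b c :=
    fun b c => Continuous.intervalIntegrable (by fun_prop) _ _
  have hiw : ∀ b c : ℝ, IntervalIntegrable (fun y => |y| ^ a * q.eval y ^ 2) volume b c :=
    fun b c => Continuous.intervalIntegrable (by fun_prop) _ _
  have hmid : ∫ y in (-h)..h, q.eval y ^ 2 ≤ I / 2 := by
    calc ∫ y in (-h)..h, q.eval y ^ 2 ≤ ∫ y in (-h)..h, 8 * N * I := by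
          refine intervalIntegral.integral_mono_on (by linarith) (hii _ _)
            (by simp) fun x hx => hpt x ?_
          rw [abs_le]; constructor <;> linarith [hx.1, hx.2]
      _ = I / 2 := by
          rw [intervalIntegral.integral_const, smul_eq_mul]
          linear_combination (I / 2) * hhN
  have hsplit : I = (∫ y in (-1)..(-h), q.eval y ^ 2) + (∫ y in (-h)..h, q.eval y ^ 2) +
      ∫ y in h..1, q.eval y ^ 2 := by
    rw [intervalIntegral.integral_add_adjacent_intervals (hii _ _) (hii _ _),
      intervalIntegral.integral_add_adjacent_intervals (hii _ _) (hii _ _)]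
  have hsplitw : ∫ y in (-1)..1, |y| ^ a * q.eval y ^ 2 =
      (∫ y in (-1)..(-h), |y| ^ a * q.eval y ^ 2) + (∫ y in (-h)..h, |y| ^ a * q.eval y ^ 2) +
      ∫ y in h..1, |y| ^ a * q.eval y ^ 2 := by
    rw [intervalIntegral.integral_add_adjacent_intervals (hiw _ _) (hiw _ _),
      intervalIntegral.integral_add_adjacent_intervals (hiw _ _) (hiw _ _)]
  have hl : h ^ a * ∫ y in (-1)..(-h), q.eval y ^ 2 ≤
      ∫ y in (-1)..(-h), |y| ^ a * q.eval y ^ 2 := by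
    rw [← intervalIntegral.integral_const_mul]
    refine intervalIntegral.integral_mono_on (by linarith) ((hii _ _).const_mul _) (hiw _ _)
      fun x hx => ?_
    gcongr
    exact le_abs.2 (Or.inr (by linarith [hx.2]))
  have hr : h ^ a * ∫ y in h..1, q.eval y ^ 2 ≤ ∫ y in h..1, |y| ^ a * q.eval y ^ 2 := by
    rw [← intervalIntegral.integral_const_mul]
    refine intervalIntegral.integral_mono_on (by linarith) ((hii _ _).const_mul _) (hiw _ _)
      fun x hx => ?_
    gcongr
    exact le_abs.2 (Or.inl hx.1)
  have hm : 0 ≤ ∫ y in (-h)..h, |y| ^ a * q.eval y ^ 2 :=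
    intervalIntegral.integral_nonneg (by linarith) fun y _ => by positivity
  have hfin : h ^ a * (I / 2) ≤ ∫ y in (-1)..1, |y| ^ a * q.eval y ^ 2 := by
    have : h ^ a * (I / 2) ≤ h ^ a * ((∫ y in (-1)..(-h), q.eval y ^ 2) +
        ∫ y in h..1, q.eval y ^ 2) := by
      gcongr
      linarith
    rw [hsplitw]
    linarith
  have hpow : h ^ a * (32 * N) ^ a = 1 := by rw [← mul_pow, hhN, one_pow]
  calc q.eval 0 ^ 2 ≤ 8 * N * I := hpt 0 (by norm_num)
    _ = 16 * N * (32 * N) ^ a * (h ^ a * (I / 2)) := by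
      linear_combination (-(8 * N * I)) * hpow
    _ ≤ _ := by gcongr

/-- A polynomial of degree less than `m` that equals `1` at `1` and decays quickly on the scale
`1 / m ^ 2`. -/
theorem exists_polynomial_decay {m : ℕ} (hm : 1 ≤ m) :
    ∃ F : ℝ[X], F.natDegree ≤ m - 1 ∧ F.eval 1 = 1 ∧
      ∀ x : ℝ, |x| ≤ 1 → |F.eval x| * (1 + m ^ 2 * (1 - x)) ≤ 3 := by
  have hm' : (1 : ℝ) ≤ m := by exact_mod_cast hm
  have hroot : (T ℝ m - 1).IsRoot 1 := by simp
  -- The kernel is this difference quotient divided by `m ^ 2 = T_m'(1)`. The mean value theorem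
  -- with `|T_m'| ≤ m ^ 2` bounds it by `1`, and `|T_m - 1| ≤ 2` gives the decay; the two add up to
  -- `3`.
  set G := (T ℝ m - 1) /ₘ (X - C 1) with hG
  have hmul : (X - C 1) * G = T ℝ m - 1 := mul_divByMonic_eq_iff_isRoot.2 hroot
  have heval : ∀ x, (x - 1) * G.eval x = (T ℝ m).eval x - 1 := fun x => by
    have := congrArg (eval x) hmul
    simpa using this
  have hder1 : (derivative (T ℝ m)).eval 1 = (m : ℝ) ^ 2 := by
    rw [T_derivative_eq_U]
    simp
    ring
  have hG1 : G.eval 1 = (m : ℝ) ^ 2 := by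
    have := congrArg (fun p => (derivative p).eval 1) hmul
    simpa [hder1] using this
  have hder : ∀ x : ℝ, |x| ≤ 1 → |(derivative (T ℝ m)).eval x| ≤ (m : ℝ) ^ 2 := fun x hx => by
    have := abs_iterate_derivative_T_real_le m 1 hx
    rwa [Function.iterate_one, hder1] at this
  have hGb : ∀ x : ℝ, |x| ≤ 1 → |G.eval x| ≤ (m : ℝ) ^ 2 := fun x hx => by
    rcases eq_or_ne x 1 with rfl | hne
    · rw [hG1, abs_of_nonneg (by positivity)]
    have h1 : ‖(T ℝ m).eval x - (T ℝ m).eval 1‖ ≤ (m : ℝ) ^ 2 * ‖x - 1‖ := by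
      refine (convex_Icc (-1 : ℝ) 1).norm_image_sub_le_of_norm_hasDerivWithin_le
        (f := fun x => (T ℝ m).eval x) (f' := fun x => (derivative (T ℝ m)).eval x)
        (fun y _ => ((T ℝ m).hasDerivAt y).hasDerivWithinAt)
        (fun y hy => hder y (abs_le.2 hy)) (Set.right_mem_Icc.2 (by norm_num)) (abs_le.1 hx)
    rw [T_eval_one, ← heval, norm_mul, mul_comm] at h1
    exact le_of_mul_le_mul_right h1 (norm_pos_iff.2 (sub_ne_zero.2 hne))
  have hGb' : ∀ x : ℝ, |x| ≤ 1 → |G.eval x| * (1 - x) ≤ 2 := fun x hx => by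
    have hx' := abs_le.1 hx
    have h1 := congrArg abs (heval x)
    rw [abs_mul, abs_of_nonpos (by linarith : x - 1 ≤ 0)] at h1
    have h2 := abs_le.1 (abs_eval_T_real_le_one m hx)
    have h3 : |(T ℝ m).eval x - 1| ≤ 2 := abs_le.2 ⟨by linarith, by linarith⟩
    linarith
  refine ⟨C ((m : ℝ) ^ 2)⁻¹ * G, ?_, ?_, fun x hx => ?_⟩
  · refine (natDegree_C_mul_le _ _).trans ?_
    rw [hG, natDegree_divByMonic _ (monic_X_sub_C 1), natDegree_X_sub_C]
    refine Nat.sub_le_sub_right ?_ 1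
    refine (natDegree_sub_le _ _).trans ?_
    simp [natDegree_T]
  · rw [eval_mul, eval_C, hG1]
    field_simp
  · rw [eval_mul, eval_C, abs_mul, abs_of_nonneg (by positivity : (0 : ℝ) ≤ ((m : ℝ) ^ 2)⁻¹),
      mul_assoc, inv_mul_le_iff₀ (by positivity)]
    have h1 := hGb x hx
    have h2 : (m : ℝ) ^ 2 * (|G.eval x| * (1 - x)) ≤ (m : ℝ) ^ 2 * 2 := by
      gcongr
      exact hGb' x hx
    nlinarith

end Univariate

/-! ### Multivariate polynomials as functions. -/

section PolySpace

variable {d n : ℕ} {P : EuclideanSpace ℝ (Fin d) → ℝ}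

theorem aeval_coord_apply (p : MvPolynomial (Fin d) ℝ) (x : EuclideanSpace ℝ (Fin d)) :
    MvPolynomial.aeval (fun (i : Fin d) (x : EuclideanSpace ℝ (Fin d)) => x i) p x =
      MvPolynomial.eval (fun i => x i) p := by
  induction p using MvPolynomial.induction_on with
  | C a => simp [Pi.algebraMap_apply]
  | add p q hp hq => rw [map_add, map_add, Pi.add_apply, hp, hq]
  | mul_X p i hp => rw [map_mul, map_mul, Pi.mul_apply, hp, MvPolynomial.aeval_X,
      MvPolynomial.eval_X]

theorem mem_polySpace : P ∈ polySpace d n ↔ ∃ p : MvPolynomial (Fin d) ℝ, p.totalDegree ≤ n ∧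
    ∀ x, P x = MvPolynomial.eval (fun i => x i) p := by
  simp only [polySpace, Submodule.mem_map, MvPolynomial.mem_restrictTotalDegree]
  refine exists_congr fun p => and_congr_right fun _ => ?_
  rw [funext_iff]
  refine forall_congr' fun x => ?_
  rw [AlgHom.toLinearMap_apply, aeval_coord_apply, eq_comm]

instance : Module.Finite ℝ (polySpace d n) := by
  unfold polySpace; infer_instance

theorem continuous_of_mem_polySpace (hP : P ∈ polySpace d n) : Continuous P := by
  obtain ⟨p, -, hp⟩ := mem_polySpace.1 hP
  rw [funext hp]
  exact (MvPolynomial.continuous_eval p).comp (by fun_prop)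

/-- The restriction of a polynomial to a parabola is a univariate polynomial. -/
theorem exists_polynomial_comp_parabola (hP : P ∈ polySpace d n)
    (x a v : EuclideanSpace ℝ (Fin d)) :
    ∃ q : Polynomial ℝ, q.natDegree ≤ n * 2 ∧
      ∀ ρ : ℝ, q.eval ρ = P (x + ρ ^ 2 • a + ρ • v) := by
  obtain ⟨p, hdeg, hp⟩ := mem_polySpace.1 hP
  refine ⟨MvPolynomial.aeval (fun i => Polynomial.C (x i) + Polynomial.C (a i) * Polynomial.X ^ 2 +
    Polynomial.C (v i) * Polynomial.X) p, ?_, fun ρ => ?_⟩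
  · refine MvPolynomial.aeval_natDegree_le p hdeg _ fun i => ?_
    compute_degree
  · rw [hp, ← Polynomial.coe_evalRingHom, MvPolynomial.aeval_def, MvPolynomial.hom_eval₂,
      MvPolynomial.eval, MvPolynomial.eval₂Hom]
    simp only [RingHom.coe_mk, MonoidHom.coe_mk, OneHom.coe_mk]
    congr 1
    · ext; simp
    · ext i; simp; ring

theorem comp_inner_mem_polySpace {q : Polynomial ℝ} (hq : q.natDegree ≤ n)
    (e : EuclideanSpace ℝ (Fin d)) :
    (fun y : EuclideanSpace ℝ (Fin d) => q.eval (inner ℝ e y)) ∈ polySpace d n := by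
  rw [mem_polySpace]
  refine ⟨Polynomial.aeval (∑ i, MvPolynomial.C (e i) * MvPolynomial.X i) q, ?_, fun x => ?_⟩
  · have hl : (∑ i, MvPolynomial.C (e i) * MvPolynomial.X i :
        MvPolynomial (Fin d) ℝ).totalDegree ≤ 1 := by
      refine MvPolynomial.totalDegree_finsetSum_le fun i _ => ?_
      refine (MvPolynomial.totalDegree_mul _ _).trans ?_
      simp
    rw [Polynomial.aeval_eq_sum_range]
    refine MvPolynomial.totalDegree_finsetSum_le fun k hk => ?_
    refine (MvPolynomial.totalDegree_smul_le _ _).trans ?_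
    refine (MvPolynomial.totalDegree_pow _ _).trans ?_
    calc k * _ ≤ k * 1 := Nat.mul_le_mul_left _ hl
      _ ≤ n := by rw [mul_one]; exact (Nat.lt_succ_iff.1 (Finset.mem_range.1 hk)).trans hq
  · rw [Polynomial.aeval_def, Polynomial.hom_eval₂]
    have h1 : MvPolynomial.eval (fun i => x i) (∑ i, MvPolynomial.C (e i) * MvPolynomial.X i) =
        inner ℝ e x := by
      simp [PiLp.inner_apply, mul_comm]
    rw [h1, Polynomial.eval]
    congr 1
    ext; simp

/-- On the line from `c` to any point, `P` is a univariate polynomial with infinitely many roots.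
This makes the `L²` form on the polynomial space definite. -/
theorem eq_zero_of_eqOn_ball (hP : P ∈ polySpace d n) {c : EuclideanSpace ℝ (Fin d)} {r : ℝ}
    (hr : 0 < r) (h0 : ∀ y ∈ Metric.ball c r, P y = 0) : P = 0 := by
  funext y
  obtain ⟨q, -, hq⟩ := exists_polynomial_comp_parabola hP c 0 (y - c)
  have hroot : ∀ᶠ ρ in nhds (0 : ℝ), q.IsRoot ρ := by
    have hcont : Filter.Tendsto (fun ρ : ℝ => c + ρ ^ 2 • (0 : EuclideanSpace ℝ (Fin d)) +
        ρ • (y - c)) (nhds 0) (nhds c) := by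
      have : Continuous (fun ρ : ℝ => c + ρ ^ 2 • (0 : EuclideanSpace ℝ (Fin d)) +
        ρ • (y - c)) := by fun_prop
      simpa using this.tendsto 0
    filter_upwards [hcont (Metric.ball_mem_nhds c hr)] with ρ hρ
    rw [Polynomial.IsRoot, hq]
    exact h0 _ hρ
  have hq0 : q = 0 := Polynomial.eq_zero_of_infinite_isRoot q (infinite_of_mem_nhds 0 hroot)
  have := hq 1
  rw [hq0] at this
  simpa using this.symm

theorem memLp_of_mem_polySpace (hP : P ∈ polySpace d n) {D : Set (EuclideanSpace ℝ (Fin d))}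
    (hD : IsCompact D) : MemLp P 2 (volume.restrict D) :=
  by
  have hc := continuous_of_mem_polySpace hP
  obtain ⟨C, hC⟩ := hD.exists_bound_of_continuousOn hc.continuousOn
  have : IsFiniteMeasure (volume.restrict D) := ⟨by simpa using hD.measure_lt_top⟩
  exact MemLp.of_bound hc.aestronglyMeasurable C
    ((ae_restrict_iff' hD.measurableSet).2 (Filter.Eventually.of_forall hC))

end PolySpace

/-! ### Orthonormal bases and the extremal property of the Christoffel function. -/

section Christoffel

variable {d n : ℕ} {D : Set (EuclideanSpace ℝ (Fin d))}

theorem exists_isOrthonormalBasisOn (hD : IsCompact D) {c : EuclideanSpace ℝ (Fin d)} {r : ℝ}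
    (hr : 0 < r) (hball : Metric.ball c r ⊆ D) :
    ∃ φ : Fin (Module.finrank ℝ (polySpace d n)) → EuclideanSpace ℝ (Fin d) → ℝ,
      IsOrthonormalBasisOn (polySpace d n) D φ := by
  have hint : ∀ f g : polySpace d n, Integrable (fun x => f.1 x * g.1 x) (volume.restrict D) :=
    fun f g => (memLp_of_mem_polySpace f.2 hD).integrable_mul (memLp_of_mem_polySpace g.2 hD)
  let core : InnerProductSpace.Core ℝ (polySpace d n) :=
    { inner := fun f g => ∫ x in D, f.1 x * g.1 x
      conj_inner_symm := fun f g => by simp [mul_comm]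
      re_inner_nonneg := fun f => integral_nonneg fun x => mul_self_nonneg _
      add_left := fun f g h => by
        rw [← integral_add (hint f h) (hint g h)]
        refine integral_congr_ae (Filter.Eventually.of_forall fun x => ?_)
        simp [add_mul]
      smul_left := fun f g a => by
        rw [RCLike.conj_to_real, ← integral_const_mul]
        refine integral_congr_ae (Filter.Eventually.of_forall fun x => ?_)
        simp [mul_assoc]
      -- Zero norm gives vanishing almost everywhere on the ball, then everywhere on it by
      -- continuity, then identically.
      definite := fun f hf => by
        have h1 := (integral_eq_zero_iff_of_nonneg (fun x => mul_self_nonneg (f.1 x))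
          (hint f f)).1 hf
        have h2 : f.1 =ᵐ[volume.restrict (Metric.ball c r)] (fun _ => (0 : ℝ)) := by
          filter_upwards [ae_restrict_of_ae_restrict_of_subset hball h1] with x hx
          simpa using hx
        have h3 := Measure.eqOn_open_of_ae_eq h2 Metric.isOpen_ball
          (continuous_of_mem_polySpace f.2).continuousOn continuousOn_const
        exact Subtype.ext (eq_zero_of_eqOn_ball f.2 hr h3) }
  let _ : NormedAddCommGroup (polySpace d n) := core.toNormedAddCommGroup
  let _ : InnerProductSpace ℝ (polySpace d n) := InnerProductSpace.ofCore core.toCore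
  let b := stdOrthonormalBasis ℝ (polySpace d n)
  refine ⟨fun k => (b k).1, fun k => memLp_of_mem_polySpace (b k).2 hD, ?_, fun j k => ?_⟩
  · have h := congrArg (Submodule.map (polySpace d n).subtype) b.toBasis.span_eq
    rw [Submodule.map_span, Submodule.map_top, Submodule.range_subtype, ← Set.range_comp] at h
    refine Eq.trans ?_ h
    congr 2
  · have h := orthonormal_iff_ite.1 b.orthonormal j k
    exact h

variable {S : Submodule ℝ (EuclideanSpace ℝ (Fin d) → ℝ)}
  {φ : Fin (Module.finrank ℝ S) → EuclideanSpace ℝ (Fin d) → ℝ}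

theorem IsOrthonormalBasisOn.integral_sum_sq (hφ : IsOrthonormalBasisOn S D φ)
    (c : Fin (Module.finrank ℝ S) → ℝ) :
    ∫ x in D, (∑ k, c k * φ k x) ^ 2 = ∑ k, c k ^ 2 := by
  have hint : ∀ j l, Integrable (fun y => φ j y * φ l y) (volume.restrict D) :=
    fun j l => (hφ.memLp j).integrable_mul (hφ.memLp l)
  have e : ∀ x, (∑ k, c k * φ k x) ^ 2 = ∑ j, ∑ k, (c j * c k) * (φ j x * φ k x) := fun x => by
    rw [sq, Finset.sum_mul_sum]
    exact Finset.sum_congr rfl fun j _ => Finset.sum_congr rfl fun k _ => by ring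
  simp_rw [e]
  rw [integral_finsetSum _ fun j _ => integrable_finsetSum _ fun k _ => (hint j k).const_mul _]
  refine Finset.sum_congr rfl fun j _ => ?_
  rw [integral_finsetSum _ fun k _ => (hint j k).const_mul _]
  simp [integral_const_mul, hφ.orthonormal, sq]

theorem sq_le_christoffelAt_mul (hφ : IsOrthonormalBasisOn S D φ)
    {P : EuclideanSpace ℝ (Fin d) → ℝ} (hP : P ∈ S) (x : EuclideanSpace ℝ (Fin d)) :
    P x ^ 2 ≤ christoffelAt S D x * ∫ y in D, P y ^ 2 := by
  rw [← hφ.span_eq, Submodule.mem_span_range_iff_exists_fun] at hP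
  obtain ⟨c, rfl⟩ := hP
  simp only [Finset.sum_apply, Pi.smul_apply, smul_eq_mul]
  rw [hφ.integral_sum_sq, christoffelAt_eq S D φ hφ, mul_comm]
  exact Finset.sum_mul_sq_le_sq_mul_sq _ _ _

/-- The test function is the reproducing kernel `∑ φ_k(x) φ_k`: its value at `x` and its squared
norm are both the sum of squares `A`, so `A ^ 2 ≤ K * A`. -/
theorem christoffelAt_le (hφ : IsOrthonormalBasisOn S D φ) {x : EuclideanSpace ℝ (Fin d)} {K : ℝ}
    (hK : 0 ≤ K) (h : ∀ P ∈ S, P x ^ 2 ≤ K * ∫ y in D, P y ^ 2) : christoffelAt S D x ≤ K := by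
  rw [christoffelAt_eq S D φ hφ]
  set A := ∑ k, φ k x ^ 2 with hA
  have hmem : (∑ k, φ k x • φ k) ∈ S := by
    have hk : ∀ k, φ k ∈ S := fun k => hφ.span_eq.le (Submodule.subset_span ⟨k, rfl⟩)
    exact Submodule.sum_mem _ fun k _ => Submodule.smul_mem _ _ (hk k)
  have h1 := h _ hmem
  simp only [Finset.sum_apply, Pi.smul_apply, smul_eq_mul] at h1
  rw [hφ.integral_sum_sq, ← hA] at h1
  have h2 : ∑ k, φ k x * φ k x = A := Finset.sum_congr rfl fun k _ => (sq _).symm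
  rw [h2] at h1
  rcases (show 0 ≤ A from Finset.sum_nonneg fun k _ => sq_nonneg _).eq_or_lt with h0 | hpos
  · rwa [← h0]
  · rw [sq] at h1
    exact le_of_mul_le_mul_right h1 hpos

end Christoffel

/-! ### Adapted coordinates and integration along parabolas. -/

section Coordinates

open ENNReal

variable {k : ℕ}

/-- Orthonormal coordinates adapted to a unit vector `e`. -/
theorem exists_adapted_coordinates {e : EuclideanSpace ℝ (Fin (k + 1))} (he : ‖e‖ = 1) :
    ∃ B : (ℝ × (Fin k → ℝ)) →ₗ[ℝ] EuclideanSpace ℝ (Fin (k + 1)),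
      B (1, 0) = e ∧ (∀ s z, ‖B (s, z)‖ ^ 2 = s ^ 2 + ∑ i, z i ^ 2) ∧
      (∀ s z, inner ℝ e (B (s, z)) = s) ∧ MeasurePreserving B volume volume := by
  obtain ⟨b, hb⟩ := Orthonormal.exists_orthonormalBasis_extension_of_card_eq (𝕜 := ℝ)
    (E := EuclideanSpace ℝ (Fin (k + 1))) (ι := Fin (k + 1)) (by simp)
    (v := fun _ => e) (s := {0}) (by
      rw [orthonormal_iff_ite]
      rintro ⟨i, hi⟩ ⟨j, hj⟩
      simp only [Set.mem_singleton_iff] at hi hj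
      subst hi; subst hj
      simp [he])
  have hb0 : b 0 = e := hb 0 (Set.mem_singleton 0)
  let B : (ℝ × (Fin k → ℝ)) →ₗ[ℝ] EuclideanSpace ℝ (Fin (k + 1)) :=
    { toFun := fun p => b.repr.symm (WithLp.toLp 2 (Fin.cons p.1 p.2 : Fin (k + 1) → ℝ))
      map_add' := fun p q => by
        rw [← map_add]
        congr 1
        ext i
        refine Fin.cases ?_ (fun i => ?_) i <;> simp
      map_smul' := fun c p => by
        rw [RingHom.id_apply, ← map_smul]
        congr 1
        ext i
        refine Fin.cases ?_ (fun i => ?_) i <;> simp }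
  have hB : ∀ p, B p = b.repr.symm (WithLp.toLp 2 (Fin.cons p.1 p.2 : Fin (k + 1) → ℝ)) :=
    fun _ => rfl
  refine ⟨B, ?_, fun s z => ?_, fun s z => ?_, ?_⟩
  · rw [hB, ← hb0, LinearIsometryEquiv.symm_apply_eq, b.repr_self]
    ext i
    refine Fin.cases ?_ (fun i => ?_) i <;> simp
  · rw [hB, LinearIsometryEquiv.norm_map, EuclideanSpace.norm_sq_eq, Fin.sum_univ_succ]
    simp
  · rw [hB, ← hb0, ← b.repr_apply_apply, LinearIsometryEquiv.apply_symm_apply]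
    simp
  · have h1 := (volume_preserving_piFinSuccAbove (fun _ : Fin (k + 1) => ℝ) 0).symm
    have h2 := b.measurePreserving_repr_symm.comp
      ((PiLp.volume_preserving_toLp (Fin (k + 1))).comp h1)
    refine (congrArg (fun f => MeasurePreserving f volume volume) ?_).mp h2
    funext p
    rw [hB]
    simp only [Function.comp_apply]
    congr 2
    simp [MeasurableEquiv.piFinSuccAbove, Fin.insertNthEquiv]

theorem lintegral_eq_mul_lintegral_smul {E : Type*} [NormedAddCommGroup E] [NormedSpace ℝ E]
    [MeasurableSpace E] [BorelSpace E] [FiniteDimensional ℝ E] (μ : Measure E)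
    [μ.IsAddHaarMeasure] {r : ℝ} (hr : r ≠ 0) {F : E → ℝ≥0∞} (hF : Measurable F) :
    ∫⁻ y, F y ∂μ = ENNReal.ofReal (|r| ^ Module.finrank ℝ E) * ∫⁻ y, F (r • y) ∂μ := by
  rw [← lintegral_map hF (measurable_const_smul r), Measure.map_addHaar_smul μ hr,
    lintegral_smul_measure, smul_eq_mul, ← mul_assoc, ← ENNReal.ofReal_mul (by positivity),
    abs_inv, abs_pow, mul_inv_cancel₀ (by positivity), ENNReal.ofReal_one, one_mul]

/-- Integration along the parabolas `ρ ↦ (ρ ^ 2, ρ • τ)`. -/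
theorem lintegral_parabola_le {H : ℝ × (Fin k → ℝ) → ℝ≥0∞} (hH : Measurable H) :
    ∫⁻ τ : Fin k → ℝ, ∫⁻ ρ in Set.Ioc (-1 : ℝ) 1,
      ENNReal.ofReal (|2 * ρ| * |ρ| ^ k) * H (ρ ^ 2, ρ • τ) ≤ 2 * ∫⁻ p, H p := by
  have hJ : Measurable fun s : ℝ => ∫⁻ z : Fin k → ℝ, H (s, z) := hH.lintegral_prod_right'
  rw [lintegral_lintegral_swap (Measurable.aemeasurable (by
    simp only [Function.uncurry_def]; fun_prop))]
  -- For fixed `ρ ≠ 0` the substitution `z = ρ • τ` uses up the factor `|ρ| ^ k`; the factor `|2 *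
  -- ρ|` is kept for `s = ρ ^ 2`.
  have hle : ∀ ρ : ℝ, ∫⁻ τ : Fin k → ℝ, ENNReal.ofReal (|2 * ρ| * |ρ| ^ k) * H (ρ ^ 2, ρ • τ) ≤
      ENNReal.ofReal |2 * ρ| * ∫⁻ z : Fin k → ℝ, H (ρ ^ 2, z) := fun ρ => by
    rcases eq_or_ne ρ 0 with rfl | hρ
    · simp
    rw [lintegral_const_mul _ (by fun_prop), lintegral_eq_mul_lintegral_smul volume hρ
      (F := fun z => H (ρ ^ 2, z)) (by fun_prop), ENNReal.ofReal_mul (by positivity), mul_assoc]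
    simp
  -- Squaring is injective only on each half of the interval, which is the source of the factor `2`.
  have hpiece : ∀ S : Set ℝ, MeasurableSet S → Set.InjOn (fun ρ : ℝ => ρ ^ 2) S →
      ∫⁻ ρ in S, ENNReal.ofReal |2 * ρ| * ∫⁻ z : Fin k → ℝ, H (ρ ^ 2, z) ≤ ∫⁻ p, H p := by
    intro S hS hinj
    have h := lintegral_image_eq_lintegral_abs_deriv_mul hS (f := fun ρ : ℝ => ρ ^ 2)
      (f' := fun ρ => 2 * ρ) (fun x _ => by simpa using (hasDerivAt_pow 2 x).hasDerivWithinAt)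
      hinj (fun s => ∫⁻ z : Fin k → ℝ, H (s, z))
    rw [← h]
    refine (setLIntegral_le_lintegral _ _).trans ?_
    rw [Measure.volume_eq_prod, lintegral_prod _ hH.aemeasurable]
  calc _ ≤ ∫⁻ ρ in Set.Ioc (-1 : ℝ) 1, ENNReal.ofReal |2 * ρ| * ∫⁻ z : Fin k → ℝ, H (ρ ^ 2, z) :=
        lintegral_mono fun ρ => hle ρ
    _ = ∫⁻ ρ in Set.Ioc (-1 : ℝ) 0 ∪ Set.Ioc 0 1,
          ENNReal.ofReal |2 * ρ| * ∫⁻ z : Fin k → ℝ, H (ρ ^ 2, z) := by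
        rw [Set.Ioc_union_Ioc_eq_Ioc (by norm_num) (by norm_num)]
    _ ≤ _ := lintegral_union_le _ _ _
    _ ≤ (∫⁻ p, H p) + ∫⁻ p, H p := by
        refine add_le_add (hpiece _ measurableSet_Ioc ?_) (hpiece _ measurableSet_Ioc ?_)
        · intro a ha b hb hab
          have : a ^ 2 = b ^ 2 := hab
          rcases sq_eq_sq_iff_eq_or_eq_neg.1 this with h | h
          · exact h
          · linarith [ha.2, hb.2]
        · intro a ha b hb hab
          have : a ^ 2 = b ^ 2 := hab
          exact (pow_left_inj₀ ha.1.le hb.1.le two_ne_zero).1 this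
    _ = 2 * ∫⁻ p, H p := (two_mul _).symm

theorem lintegral_eq_adapted {x : EuclideanSpace ℝ (Fin (k + 1))} {r : ℝ} (hr : 0 < r)
    {B : (ℝ × (Fin k → ℝ)) →ₗ[ℝ] EuclideanSpace ℝ (Fin (k + 1))}
    (hB : MeasurePreserving B volume volume) {F : EuclideanSpace ℝ (Fin (k + 1)) → ℝ≥0∞}
    (hF : Measurable F) :
    ∫⁻ y, F y = ENNReal.ofReal (r ^ (k + 1)) * ∫⁻ p, F (x + r • B p) := by
  rw [← lintegral_add_left_eq_self F x,
    lintegral_eq_mul_lintegral_smul volume hr.ne' (by fun_prop), abs_of_pos hr,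
    finrank_euclideanSpace_fin]
  congr 1
  exact (hB.lintegral_comp (f := fun y => F (x + r • y)) (by fun_prop)).symm

end Coordinates

/-! ### Upper bound at a point on the surface of an interior ball. -/

section UpperBound

open ENNReal

theorem exists_sq_le_integral_of_closedBall_subset (k : ℕ) {r : ℝ} (hr : 0 < r) :
    ∃ K : ℝ, 0 < K ∧ ∀ n : ℕ, 1 ≤ n → ∀ D : Set (EuclideanSpace ℝ (Fin (k + 1))), IsCompact D →
      ∀ x e : EuclideanSpace ℝ (Fin (k + 1)), ‖e‖ = 1 → Metric.closedBall (x + r • e) r ⊆ D →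
      ∀ P ∈ polySpace (k + 1) n, P x ^ 2 ≤ K * (n : ℝ) ^ (k + 2) * ∫ y in D, P y ^ 2 := by
  set W : Set (Fin k → ℝ) := {τ | ∑ i, τ i ^ 2 < 1} with hW
  have hWo : IsOpen W := isOpen_lt (by fun_prop) continuous_const
  have hWpos : 0 < volume W := hWo.measure_pos volume ⟨0, by simp [hW]⟩
  have hWb : Bornology.IsBounded W := by
    refine (Metric.isBounded_closedBall (x := (0 : Fin k → ℝ)) (r := 1)).subset fun τ hτ => ?_
    rw [mem_closedBall_zero_iff, pi_norm_le_iff_of_nonneg zero_le_one]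
    intro i
    have h1 : τ i ^ 2 ≤ ∑ i, τ i ^ 2 :=
      Finset.single_le_sum (f := fun i => τ i ^ 2) (fun i _ => sq_nonneg _) (Finset.mem_univ i)
    have h2 : ∑ i, τ i ^ 2 < 1 := hτ
    rw [Real.norm_eq_abs, ← sq_le_one_iff_abs_le_one]
    linarith
  set w := (volume W).toReal with hw
  have hwpos : 0 < w := ENNReal.toReal_pos hWpos.ne' hWb.measure_lt_top.ne
  have hwW : volume W = ENNReal.ofReal w := (ENNReal.ofReal_toReal hWb.measure_lt_top.ne).symm
  -- The constant of `eval_zero_sq_le_integral_weight` for degree `2 * n` and exponent `k + 1`, with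
  -- `n ^ (k + 2)` taken out.
  set c₀ : ℝ := 16 * 2 * (32 * 2) ^ (k + 1) with hc₀
  refine ⟨c₀ * 2 / (w * r ^ (k + 1)), by positivity, fun n hn D hD x e he hball P hP => ?_⟩
  obtain ⟨B, hBe, hBn, -, hBm⟩ := exists_adapted_coordinates he
  have hPc := continuous_of_mem_polySpace hP
  have hBlin : ∀ (ρ : ℝ) (τ : Fin k → ℝ),
      B (ρ ^ 2, ρ • τ) = ρ ^ 2 • e + ρ • B (0, τ) := fun ρ τ => by
    rw [← hBe, ← map_smul, ← map_smul, ← map_add]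
    congr 1
    simp
  set F : EuclideanSpace ℝ (Fin (k + 1)) → ℝ≥0∞ :=
    D.indicator (fun y => ENNReal.ofReal (P y ^ 2)) with hF
  have hFm : Measurable F :=
    (ENNReal.measurable_ofReal.comp (hPc.pow 2).measurable).indicator hD.measurableSet
  -- The parabola stays in the ball because `(1 - ρ ^ 2) ^ 2 + ρ ^ 2 * |τ| ^ 2 ≤ 1 - ρ ^ 2 + ρ ^ 4 ≤
  -- 1`, where `|τ|` is the Euclidean length.
  have hmem : ∀ τ ∈ W, ∀ ρ ∈ Set.Ioc (-1 : ℝ) 1, x + r • B (ρ ^ 2, ρ • τ) ∈ D := by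
    intro τ hτ ρ hρ
    apply hball
    rw [Metric.mem_closedBall, dist_eq_norm, add_sub_add_left_eq_sub, ← smul_sub, norm_smul,
      Real.norm_of_nonneg hr.le]
    refine mul_le_of_le_one_right hr.le ?_
    rw [← sq_le_one_iff₀ (norm_nonneg _), ← hBe, ← map_sub, Prod.mk_sub_mk, sub_zero, hBn]
    have h1 : ∑ i, (ρ • τ) i ^ 2 = ρ ^ 2 * ∑ i, τ i ^ 2 := by
      rw [Finset.mul_sum]
      exact Finset.sum_congr rfl fun i _ => by rw [Pi.smul_apply, smul_eq_mul, mul_pow]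
    have h2 : ∑ i, τ i ^ 2 < 1 := hτ
    have h3 : ρ ^ 2 ≤ 1 := by rw [sq_le_one_iff_abs_le_one, abs_le]; exact ⟨hρ.1.le, hρ.2⟩
    rw [h1]
    nlinarith [sq_nonneg ρ]
  have hτ : ∀ τ ∈ W, ENNReal.ofReal (P x ^ 2) ≤ ENNReal.ofReal (c₀ * (n : ℝ) ^ (k + 2)) *
      ∫⁻ ρ in Set.Ioc (-1 : ℝ) 1,
        ENNReal.ofReal (|2 * ρ| * |ρ| ^ k) * F (x + r • B (ρ ^ 2, ρ • τ)) := by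
    intro τ hτ
    obtain ⟨q, hqdeg, hq⟩ := exists_polynomial_comp_parabola hP x (r • e) (r • B (0, τ))
    have hq' : ∀ ρ : ℝ, q.eval ρ = P (x + r • B (ρ ^ 2, ρ • τ)) := fun ρ => by
      rw [hq, hBlin, smul_add, ← add_assoc, smul_comm r (ρ ^ 2), smul_comm r ρ]
    have h0 : q.eval 0 = P x := by simp [hq]
    have h1 := eval_zero_sq_le_integral_weight (by omega : 1 ≤ n * 2) hqdeg (k + 1)
    rw [h0] at h1
    have h2 : 16 * ((n * 2 : ℕ) : ℝ) * (32 * ((n * 2 : ℕ) : ℝ)) ^ (k + 1) =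
        c₀ * (n : ℝ) ^ (k + 2) := by
      rw [hc₀]; push_cast; ring
    rw [h2, intervalIntegral.integral_of_le (by norm_num)] at h1
    refine (ENNReal.ofReal_le_ofReal h1).trans ?_
    rw [ENNReal.ofReal_mul (by positivity)]
    gcongr
    rw [ofReal_integral_eq_lintegral_ofReal]
    · refine setLIntegral_mono' measurableSet_Ioc fun ρ hρ => ?_
      rw [hF, Set.indicator_of_mem (hmem τ hτ ρ hρ), ← hq', ← ENNReal.ofReal_mul (by positivity)]
      refine ENNReal.ofReal_le_ofReal ?_
      gcongr
      rw [pow_succ', abs_mul]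
      gcongr
      refine le_mul_of_one_le_left (abs_nonneg _) ?_
      norm_num
    · exact (Continuous.integrableOn_Ioc (by fun_prop))
    · exact Filter.Eventually.of_forall fun ρ => by positivity
  -- The left side of `hτ` does not depend on `τ`, so integrating over `W` merely multiplies it by
  -- the volume `w`.
  have hmain : ENNReal.ofReal (P x ^ 2) * ENNReal.ofReal w ≤
      ENNReal.ofReal (c₀ * (n : ℝ) ^ (k + 2)) * (2 * ∫⁻ p, F (x + r • B p)) := by
    have hBmeas : Measurable fun p => F (x + r • B p) :=
      hFm.comp ((hBm.measurable.const_smul r).const_add x)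
    calc ENNReal.ofReal (P x ^ 2) * ENNReal.ofReal w
        = ∫⁻ τ in W, ENNReal.ofReal (P x ^ 2) := by rw [setLIntegral_const, hwW]
      _ ≤ ∫⁻ τ in W, ENNReal.ofReal (c₀ * (n : ℝ) ^ (k + 2)) * ∫⁻ ρ in Set.Ioc (-1 : ℝ) 1,
          ENNReal.ofReal (|2 * ρ| * |ρ| ^ k) * F (x + r • B (ρ ^ 2, ρ • τ)) :=
        setLIntegral_mono' hWo.measurableSet hτ
      _ = ENNReal.ofReal (c₀ * (n : ℝ) ^ (k + 2)) * ∫⁻ τ in W, ∫⁻ ρ in Set.Ioc (-1 : ℝ) 1,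
          ENNReal.ofReal (|2 * ρ| * |ρ| ^ k) * F (x + r • B (ρ ^ 2, ρ • τ)) :=
        lintegral_const_mul' _ _ ENNReal.ofReal_ne_top
      _ ≤ _ := by
        gcongr
        exact (setLIntegral_le_lintegral _ _).trans (lintegral_parabola_le hBmeas)
  have hint : Integrable (fun y => P y ^ 2) (volume.restrict D) :=
    (memLp_of_mem_polySpace hP hD).integrable_sq
  have hFI : ∫⁻ y, F y = ENNReal.ofReal (∫ y in D, P y ^ 2) := by
    rw [hF, lintegral_indicator hD.measurableSet, ofReal_integral_eq_lintegral_ofReal hint]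
    exact Filter.Eventually.of_forall fun y => sq_nonneg _
  have hI0 : 0 ≤ ∫ y in D, P y ^ 2 := integral_nonneg fun y => sq_nonneg _
  rw [lintegral_eq_adapted (x := x) hr hBm hFm] at hFI
  have hfin : ENNReal.ofReal (P x ^ 2 * w * r ^ (k + 1)) ≤
      ENNReal.ofReal (c₀ * (n : ℝ) ^ (k + 2) * 2 * ∫ y in D, P y ^ 2) := by
    calc ENNReal.ofReal (P x ^ 2 * w * r ^ (k + 1))
        = ENNReal.ofReal (P x ^ 2) * ENNReal.ofReal w * ENNReal.ofReal (r ^ (k + 1)) := by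
          rw [ENNReal.ofReal_mul (by positivity), ENNReal.ofReal_mul (by positivity)]
      _ ≤ ENNReal.ofReal (c₀ * (n : ℝ) ^ (k + 2)) * (2 * ∫⁻ p, F (x + r • B p)) *
            ENNReal.ofReal (r ^ (k + 1)) := by gcongr
      _ = ENNReal.ofReal (c₀ * (n : ℝ) ^ (k + 2)) * 2 *
            (ENNReal.ofReal (r ^ (k + 1)) * ∫⁻ p, F (x + r • B p)) := by ring
      _ = _ := by
          rw [hFI, ENNReal.ofReal_mul (p := c₀ * (n : ℝ) ^ (k + 2) * 2) (by positivity),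
            ENNReal.ofReal_mul (p := c₀ * (n : ℝ) ^ (k + 2)) (by positivity), ENNReal.ofReal_ofNat]
  rw [ENNReal.ofReal_le_ofReal_iff (by positivity)] at hfin
  rw [div_mul_eq_mul_div, div_mul_eq_mul_div, le_div_iff₀ (by positivity)]
  linarith

end UpperBound

/-! ### Lower bound from a polynomial concentrated on a cap. -/

section LowerBound

open ENNReal

theorem integrable_inv_one_add_sq_mul {a : ℝ} (ha : a ≠ 0) (b : ℝ) :
    Integrable fun t : ℝ => (1 + (a * (b - t)) ^ 2)⁻¹ :=
  (((integrable_inv_one_add_sq).comp_mul_left' ha).comp_sub_left b)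

theorem integral_inv_one_add_sq_mul {a : ℝ} (ha : 0 < a) (b : ℝ) :
    ∫ t : ℝ, (1 + (a * (b - t)) ^ 2)⁻¹ = Real.pi / a := by
  rw [integral_sub_left_eq_self (fun t => (1 + (a * t) ^ 2)⁻¹) volume b,
    Measure.integral_comp_mul_left (fun t => (1 + t ^ 2)⁻¹), integral_univ_inv_one_add_sq,
    abs_of_pos (inv_pos.2 ha), smul_eq_mul, inv_mul_eq_div]

theorem integrable_cauchy_prod (k : ℕ) {a b : ℝ} (ha : a ≠ 0) (hb : b ≠ 0) :
    Integrable fun p : ℝ × (Fin k → ℝ) =>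
      (1 + (a * (1 - p.1)) ^ 2)⁻¹ * ∏ i, (1 + (b * (0 - p.2 i)) ^ 2)⁻¹ :=
  (integrable_inv_one_add_sq_mul ha 1).mul_prod
    (Integrable.fintype_prod fun _ => integrable_inv_one_add_sq_mul hb 0)

theorem integral_cauchy_prod (k : ℕ) {a b : ℝ} (ha : 0 < a) (hb : 0 < b) :
    ∫ p : ℝ × (Fin k → ℝ), (1 + (a * (1 - p.1)) ^ 2)⁻¹ * ∏ i, (1 + (b * (0 - p.2 i)) ^ 2)⁻¹ =
      Real.pi / a * (Real.pi / b) ^ k := by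
  rw [Measure.volume_eq_prod, integral_prod_mul (fun t : ℝ => (1 + (a * (1 - t)) ^ 2)⁻¹)
    (fun z : Fin k → ℝ => ∏ i, (1 + (b * (0 - z i)) ^ 2)⁻¹), integral_inv_one_add_sq_mul ha,
    integral_fintype_prod_volume_eq_pow (fun t : ℝ => (1 + (b * (0 - t)) ^ 2)⁻¹),
    integral_inv_one_add_sq_mul hb, Fintype.card_fin]

/-- Decay of a power of the univariate kernel on the unit ball. -/
theorem pow_le_cauchy_prod {k m : ℕ} {y s : ℝ} {z : Fin k → ℝ} (hs : s ^ 2 + ∑ i, z i ^ 2 ≤ 1)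
    (hy : |y| * (1 + m ^ 2 * (1 - s)) ≤ 3) :
    (y ^ (k + 2)) ^ 2 ≤ 3 ^ (2 * (k + 2)) * 2 ^ k *
      ((1 + ((m : ℝ) ^ 2 * (1 - s)) ^ 2)⁻¹ * ∏ i, (1 + (m * (0 - z i)) ^ 2)⁻¹) := by
  have hz : ∀ i, z i ^ 2 ≤ ∑ i, z i ^ 2 := fun i =>
    Finset.single_le_sum (f := fun i => z i ^ 2) (fun i _ => sq_nonneg _) (Finset.mem_univ i)
  have hz0 : 0 ≤ ∑ i, z i ^ 2 := Finset.sum_nonneg fun i _ => sq_nonneg _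
  have hs1 : s ≤ 1 := by nlinarith
  set A := (m : ℝ) ^ 2 * (1 - s) with hA
  have hA0 : 0 ≤ A := mul_nonneg (by positivity) (by linarith)
  -- On the unit ball `z i ^ 2 ≤ 1 - s ^ 2 ≤ 2 * (1 - s)`, so decay in depth on the scale `m ^ (-2)`
  -- forces decay sideways on the scale `1 / m`. The majorant is a product so that its integral is
  -- explicit.
  have hprod : ∏ i, (1 + (m * (0 - z i)) ^ 2) ≤ 2 ^ k * (1 + A) ^ k := by
    rw [← mul_pow]
    calc ∏ i, (1 + (m * (0 - z i)) ^ 2) ≤ ∏ _i : Fin k, (2 * (1 + A)) := by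
          refine Finset.prod_le_prod (fun i _ => by positivity) fun i _ => ?_
          have h1 : z i ^ 2 ≤ 2 * (1 - s) := by nlinarith [hz i, sq_nonneg (1 - s)]
          have h2 : (m : ℝ) ^ 2 * z i ^ 2 ≤ m ^ 2 * (2 * (1 - s)) := by gcongr
          have h3 : (m * (0 - z i)) ^ 2 = (m : ℝ) ^ 2 * z i ^ 2 := by ring
          rw [h3]
          linarith
      _ = (2 * (1 + A)) ^ k := by simp
  have hden : (1 + A ^ 2) * ∏ i, (1 + (m * (0 - z i)) ^ 2) ≤ 2 ^ k * (1 + A) ^ (2 * (k + 2)) := by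
    calc (1 + A ^ 2) * ∏ i, (1 + (m * (0 - z i)) ^ 2)
        ≤ (1 + A) ^ 2 * (2 ^ k * (1 + A) ^ k) := by
          gcongr
          · nlinarith
      _ = 2 ^ k * (1 + A) ^ (k + 2) := by ring
      _ ≤ 2 ^ k * (1 + A) ^ (2 * (k + 2)) := by
          gcongr
          · linarith
          · omega
  have hnum : (y ^ (k + 2)) ^ 2 * (1 + A) ^ (2 * (k + 2)) ≤ 3 ^ (2 * (k + 2)) := by
    calc (y ^ (k + 2)) ^ 2 * (1 + A) ^ (2 * (k + 2)) = (|y| * (1 + A)) ^ (2 * (k + 2)) := by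
          rw [mul_pow, ← pow_mul, mul_comm (k + 2) 2, pow_mul |y|, sq_abs, ← pow_mul]
      _ ≤ 3 ^ (2 * (k + 2)) := by gcongr
  rw [Finset.prod_inv_distrib, ← mul_inv, ← div_eq_mul_inv,
    le_div_iff₀ (by positivity)]
  calc (y ^ (k + 2)) ^ 2 * ((1 + A ^ 2) * ∏ i, (1 + (m * (0 - z i)) ^ 2))
      ≤ (y ^ (k + 2)) ^ 2 * (2 ^ k * (1 + A) ^ (2 * (k + 2))) := by gcongr
    _ = (y ^ (k + 2)) ^ 2 * (1 + A) ^ (2 * (k + 2)) * 2 ^ k := by ring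
    _ ≤ _ := by gcongr

/-- On a ball there are polynomials that are concentrated near a boundary point. -/
theorem exists_mem_polySpace_integral_le {k : ℕ} {R : ℝ} (hR : 0 < R)
    {D : Set (EuclideanSpace ℝ (Fin (k + 1)))} (hD : IsCompact D)
    (hDR : D ⊆ Metric.closedBall 0 R) {e : EuclideanSpace ℝ (Fin (k + 1))} (he : ‖e‖ = 1)
    {n m : ℕ} (hm : 1 ≤ m) (hmn : (k + 2) * (m - 1) ≤ n) :
    ∃ P ∈ polySpace (k + 1) n, P (R • e) = 1 ∧
      ∫ y in D, P y ^ 2 ≤ R ^ (k + 1) * (3 ^ (2 * (k + 2)) * 2 ^ k) * Real.pi ^ (k + 1) /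
        (m : ℝ) ^ (k + 2) := by
  have hm0 : (0 : ℝ) < m := by exact_mod_cast hm
  obtain ⟨F, hFdeg, hF1, hF⟩ := exists_polynomial_decay hm
  obtain ⟨B, -, hBn, hBi, hBm⟩ := exists_adapted_coordinates he
  set Q : Polynomial ℝ := (F.comp (Polynomial.C R⁻¹ * Polynomial.X)) ^ (k + 2) with hQ
  have hQdeg : Q.natDegree ≤ n := by
    rw [hQ]
    refine Polynomial.natDegree_pow_le.trans (le_trans ?_ hmn)
    gcongr
    refine Polynomial.natDegree_comp_le.trans ?_
    calc F.natDegree * (Polynomial.C R⁻¹ * Polynomial.X : Polynomial ℝ).natDegree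
        ≤ (m - 1) * 1 := Nat.mul_le_mul hFdeg (by compute_degree)
      _ = m - 1 := mul_one _
  have hQe : ∀ t, Q.eval t = F.eval (R⁻¹ * t) ^ (k + 2) := fun t => by simp [hQ]
  set P : EuclideanSpace ℝ (Fin (k + 1)) → ℝ := fun y => Q.eval (inner ℝ e y) with hP
  have hPmem : P ∈ polySpace (k + 1) n := comp_inner_mem_polySpace hQdeg e
  refine ⟨P, hPmem, ?_, ?_⟩
  · simp only [hP, hQe, inner_smul_right, real_inner_self_eq_norm_sq, he]
    rw [one_pow, mul_one, inv_mul_cancel₀ hR.ne', hF1, one_pow]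
  have hPc := continuous_of_mem_polySpace hPmem
  set M : ℝ := 3 ^ (2 * (k + 2)) * 2 ^ k with hM
  set C : ℝ × (Fin k → ℝ) → ℝ := fun p =>
    (1 + ((m : ℝ) ^ 2 * (1 - p.1)) ^ 2)⁻¹ * ∏ i, (1 + (m * (0 - p.2 i)) ^ 2)⁻¹ with hC
  have hC0 : ∀ p, 0 ≤ C p := fun p =>
    mul_nonneg (by positivity) (Finset.prod_nonneg fun i _ => by positivity)
  have hpt : ∀ p : ℝ × (Fin k → ℝ),
      D.indicator (fun y => ENNReal.ofReal (P y ^ 2)) (0 + R • B p) ≤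
        ENNReal.ofReal (M * C p) := by
    rintro ⟨s, z⟩
    by_cases hmem : 0 + R • B (s, z) ∈ D
    swap
    · rw [Set.indicator_of_notMem hmem]; exact zero_le
    · rw [Set.indicator_of_mem hmem]
      refine ENNReal.ofReal_le_ofReal ?_
      have hnorm : s ^ 2 + ∑ i, z i ^ 2 ≤ 1 := by
        have h1 := hDR hmem
        rw [mem_closedBall_zero_iff, zero_add, norm_smul, Real.norm_of_nonneg hR.le,
          mul_le_iff_le_one_right hR] at h1
        rw [← hBn]
        exact pow_le_one₀ (norm_nonneg _) h1
      have hPs : P (0 + R • B (s, z)) = F.eval s ^ (k + 2) := by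
        simp only [hP, hQe, zero_add, inner_smul_right, hBi]
        rw [inv_mul_cancel_left₀ hR.ne']
      rw [hPs]
      refine pow_le_cauchy_prod hnorm (hF s ?_)
      rw [← sq_le_one_iff_abs_le_one]
      have : 0 ≤ ∑ i, z i ^ 2 := Finset.sum_nonneg fun i _ => sq_nonneg _
      linarith
  have hint : Integrable (fun y => P y ^ 2) (volume.restrict D) :=
    (memLp_of_mem_polySpace hPmem hD).integrable_sq
  have hCint : Integrable fun p => M * C p :=
    (integrable_cauchy_prod k (by positivity) (by positivity)).const_mul M
  have hFm : Measurable (D.indicator fun y => ENNReal.ofReal (P y ^ 2)) :=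
    (ENNReal.measurable_ofReal.comp (hPc.pow 2).measurable).indicator hD.measurableSet
  have hle : ENNReal.ofReal (∫ y in D, P y ^ 2) ≤
      ENNReal.ofReal (R ^ (k + 1) * (M * (Real.pi / (m : ℝ) ^ 2 * (Real.pi / m) ^ k))) := by
    rw [ofReal_integral_eq_lintegral_ofReal hint
      (Filter.Eventually.of_forall fun y => sq_nonneg _), ← lintegral_indicator hD.measurableSet,
      lintegral_eq_adapted (x := 0) hR hBm hFm,
      ENNReal.ofReal_mul (by positivity),
      ← integral_cauchy_prod k (by positivity) hm0, ← integral_const_mul,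
      ofReal_integral_eq_lintegral_ofReal hCint
        (Filter.Eventually.of_forall fun p => mul_nonneg (by positivity) (hC0 p))]
    gcongr with p
    exact hpt p
  rw [ENNReal.ofReal_le_ofReal_iff (by positivity)] at hle
  refine hle.trans_eq ?_
  rw [div_pow]
  field_simp
  ring

end LowerBound

/-! ### The two bounds combined. -/

theorem mainTheorem7 (d : ℕ) (hd : 1 ≤ d) (D : Set (EuclideanSpace ℝ (Fin d)))
    (hD : IsCompact D) (hne : D.Nonempty)
    (hM : IsC1Hypersurface (frontier D))
    (ν : EuclideanSpace ℝ (Fin d) → EuclideanSpace ℝ (Fin d))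
    (hν : ∀ x ∈ frontier D, IsOutwardUnitNormal D x (ν x))
    (L : ℝ) (hL : 0 < L)
    (hLip : ∀ x ∈ frontier D, ∀ y ∈ frontier D, ‖ν x - ν y‖ ≤ L * ‖x - y‖) :
    ∃ c : ℝ, 0 < c ∧ ∀ n : ℕ, 1 ≤ n →
      c⁻¹ * (n : ℝ) ^ (d + 1) ≤ christoffelSup (polySpace d n) D ∧
      christoffelSup (polySpace d n) D ≤ c * (n : ℝ) ^ (d + 1) := by
  obtain ⟨k, rfl⟩ : ∃ k, d = k + 1 := ⟨d - 1, by omega⟩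
  have hfr : (frontier D).Nonempty := by
    rw [nonempty_frontier_iff]
    refine ⟨hne, fun h => ?_⟩
    exact noncompact_univ (EuclideanSpace ℝ (Fin (k + 1))) (h ▸ hD)
  obtain ⟨r, hr, hball⟩ := exists_closedBall_subset hD.isClosed hfr hM hν hL hLip
  obtain ⟨K, hK, hupper⟩ := exists_sq_le_integral_of_closedBall_subset k hr
  obtain ⟨x₁, hx₁⟩ := hne
  obtain ⟨e₁, he₁, hb₁⟩ := hball x₁ hx₁
  have hbasis := fun n : ℕ => exists_isOrthonormalBasisOn (n := n) hD hr
    (Metric.ball_subset_closedBall.trans hb₁)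
  obtain ⟨x₀, hx₀, hmax⟩ := hD.exists_isMaxOn ⟨x₁, hx₁⟩ (f := fun x => ‖x‖) (by fun_prop)
  have hDR : D ⊆ Metric.closedBall 0 ‖x₀‖ := fun y hy => by
    rw [mem_closedBall_zero_iff]; exact hmax hy
  -- Otherwise `D` would be the single point `0`, but it contains both `x₁` and the centre of its
  -- interior ball.
  have hR : 0 < ‖x₀‖ := by
    by_contra h
    have h1 : D ⊆ {0} := fun y hy => by
      have := hDR hy
      rw [mem_closedBall_zero_iff] at this
      rw [Set.mem_singleton_iff, ← norm_le_zero_iff]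
      linarith
    have h2 := h1 (hb₁ (Metric.mem_closedBall_self hr.le))
    have h3 := h1 hx₁
    rw [Set.mem_singleton_iff] at h2 h3
    rw [h3, zero_add, smul_eq_zero] at h2
    rcases h2 with h2 | h2
    · exact hr.ne' h2
    · rw [h2, norm_zero] at he₁; exact zero_ne_one he₁
  set R := ‖x₀‖ with hRdef
  set e := R⁻¹ • x₀ with he
  have hen : ‖e‖ = 1 := by
    rw [he, norm_smul, norm_inv, norm_norm, inv_mul_cancel₀ hR.ne']
  have hRe : R • e = x₀ := by rw [he, smul_inv_smul₀ hR.ne']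
  set M : ℝ := R ^ (k + 1) * (3 ^ (2 * (k + 2)) * 2 ^ k) * Real.pi ^ (k + 1) with hMdef
  have hMpos : 0 < M := by positivity
  have hKn : ∀ n : ℕ, 1 ≤ n → ∀ x ∈ D,
      christoffelAt (polySpace (k + 1) n) D x ≤ K * (n : ℝ) ^ (k + 1 + 1) := fun n hn x hx => by
    obtain ⟨φ, hφ⟩ := hbasis n
    obtain ⟨e, he, hb⟩ := hball x hx
    exact christoffelAt_le hφ (by positivity) (hupper n hn D hD x e he hb)
  refine ⟨max K (M * (k + 2) ^ (k + 2)), lt_max_of_lt_left hK, fun n hn => ⟨?_, ?_⟩⟩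
  -- This choice gives `(k + 2) * (m - 1) ≤ n < (k + 2) * m`: the degree fits and `m` is comparable
  -- with `n`.
  · set m := n / (k + 2) + 1 with hm
    obtain ⟨P, hP, hP1, hPI⟩ := exists_mem_polySpace_integral_le hR hD hDR hen (n := n) (m := m)
      (Nat.succ_pos _) (by rw [hm, Nat.add_sub_cancel]; exact Nat.mul_div_le n (k + 2))
    obtain ⟨φ, hφ⟩ := hbasis n
    have hnm : (n : ℝ) ≤ (k + 2) * m := by
      have := (Nat.lt_mul_div_succ n (by omega : 0 < k + 2)).le
      exact_mod_cast this
    have h1 := sq_le_christoffelAt_mul hφ hP (R • e)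
    rw [hP1, one_pow, hRe] at h1
    have hC0 : 0 ≤ christoffelAt (polySpace (k + 1) n) D x₀ := by
      rw [christoffelAt_eq _ _ φ hφ]
      exact Finset.sum_nonneg fun _ _ => sq_nonneg _
    have hmpos : (0 : ℝ) < m := by exact_mod_cast Nat.succ_pos _
    have h2 : (m : ℝ) ^ (k + 2) ≤ christoffelAt (polySpace (k + 1) n) D x₀ * M := by
      have := h1.trans (mul_le_mul_of_nonneg_left hPI hC0)
      rwa [← mul_div_assoc, le_div_iff₀ (by positivity), one_mul] at this
    have h3 : christoffelAt (polySpace (k + 1) n) D x₀ ≤ christoffelSup (polySpace (k + 1) n) D := by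
      -- The lower bound needs the upper one too, since the real `sSup` of an unbounded set is `0`
      -- by default.
      refine le_csSup ⟨K * (n : ℝ) ^ (k + 1 + 1), ?_⟩ (Set.mem_image_of_mem _ hx₀)
      rintro _ ⟨x, hx, rfl⟩
      exact hKn n hn x hx
    refine le_trans ?_ h3
    rw [inv_mul_le_iff₀ (lt_max_of_lt_left hK)]
    calc (n : ℝ) ^ (k + 1 + 1) ≤ ((k + 2) * m) ^ (k + 2) := by gcongr
      _ = (k + 2) ^ (k + 2) * (m : ℝ) ^ (k + 2) := mul_pow _ _ _
      _ ≤ (k + 2) ^ (k + 2) * (christoffelAt (polySpace (k + 1) n) D x₀ * M) := by gcongr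
      _ = M * (k + 2) ^ (k + 2) * christoffelAt (polySpace (k + 1) n) D x₀ := by ring
      _ ≤ _ := by gcongr; exact le_max_right _ _
  · refine csSup_le (Set.Nonempty.image _ ⟨x₁, hx₁⟩) ?_
    rintro _ ⟨x, hx, rfl⟩
    refine (hKn n hn x hx).trans ?_
    gcongr
    exact le_max_left _ _
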